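/- Let $n\ge 0$ and let $X_1,\dots,X_n$ be independent symmetric real random variables with $\mathbf{E}X_i^2=1$ and with logarithmically concave tails, i.e. for each $i$ the function $t\mapsto \ln \mathbf{P}(|X_i|\ge t)$ is concave from $[0,\infty)$ to $[-\infty,0]$. Write $\|Y\|_p=(\mathbf{E}|Y|^p)^{1/p}$ for a random variable $Y$, and let $\gamma_p=\|G\|_p$, where $G$ is a standard Gaussian $\mathcal{N}(0,1)$ random variable. Then for all real numbers $a_1,\dots,a_n$ and every real $p\ge 3$, the moment $\mathbf{E}\big|\sum_{i=1}^n a_iX_i\big|^p$ is finite and \[ \Big|\,\Big\|\sum_{i=1}^n a_iX_i\Big\|_p-\gamma_p\|a\|_2\Big|\le p\,\|a\|_\infty , \] where $\|a\|_2=\big(\sum_{i=1}^n a_i^2\big)^{1/2}$ and $\|a\|_\infty=\max_{1\le i\le n}|a_i|$ (equal to $0$ if $n=0$). -/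

import Mathlib

open MeasureTheory ProbabilityTheory

/-- `X` has logarithmically concave tails: `t ↦ ln P(|X| ≥ t)` is a concave function from
`[0, ∞)` to `[-∞, 0]`. The logarithm takes values in the extended reals, with `ln 0 = -∞`
(and `0 * (-∞) = 0`). -/
def HasLogConcaveTails {Ω : Type*} [MeasurableSpace Ω] (X : Ω → ℝ) (P : Measure Ω) : Prop :=
  ∀ s t a b : ℝ, 0 ≤ s → 0 ≤ t → 0 ≤ a → 0 ≤ b → a + b = 1 →
    (a : EReal) * ENNReal.log (P {ω | s ≤ |X ω|}) + (b : EReal) * ENNReal.log (P {ω | t ≤ |X ω|})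
      ≤ ENNReal.log (P {ω | a * s + b * t ≤ |X ω|})

/-- `X` is symmetric: `X` and `-X` have the same distribution. -/
def IsSymmetricRV {Ω : Type*} [MeasurableSpace Ω] (X : Ω → ℝ) (P : Measure Ω) : Prop :=
  IdentDistrib X (fun ω => -X ω) P P

/-- `γ_p`, the `p`-th norm `(E |G|^p)^(1/p)` of a standard Gaussian random variable `G`. -/
noncomputable def gaussianNorm (p : ℝ) : ℝ :=
  lpNorm (fun x : ℝ => x) (ENNReal.ofReal p) (gaussianReal 0 1)

/-!
Log-concave tails are used only through `P(|Y| ≥ s + t) ≤ P(|Y| ≥ s) P(|Y| ≥ t)`. If `Y` is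
symmetric and has such tails, then Taylor's formula with integral remainder gives, for `p ≥ 4` and
every `z`,
`|z| ^ p + p (p - 1) / 2 * Var Y * |z| ^ (p - 2) ≤ E |z + Y| ^ p
  ≤ |z| ^ p + p (p - 1) / 2 * Var Y * E |z + Y| ^ (p - 2)`;
the upper bound holds because submultiplicativity bounds the density of the remainder by a
convolution. Let `S` be a sum of independent such variables, with total variance `σ²` and every
single variance at most `M`. Adding the summands one at a time and using
`γ_p ^ p = (p - 1) γ_(p - 2) ^ (p - 2)`, these inequalities carry the estimate
`γ_p ^ p (σ² - (p / 2 + 2) M)₊ ^ (p / 2) ≤ E |S| ^ p ≤ γ_p ^ p (σ² + p / 2 * M) ^ (p / 2)`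
from `p - 2` to `p`. For `2 < p < 4` it is read off the characteristic function, since then
`|x| ^ p` is a positive mixture of the functions `cos (t x) - 1 + t² x² / 2`, and `E cos (t S)`,
a product over the summands, is compared with that of centred Gaussians of variances `σ² + M` and
`σ² - 3 M`. Taking `p`-th roots, the claim follows from `γ_p² (p / 2 + 2) ≤ p²`.
-/

section Calculus

variable {f f₁ f₂ : ℝ → ℝ}

lemma taylor_two_integral_remainder (h₁ : ∀ x, HasDerivAt f (f₁ x) x)
    (h₂ : ∀ x, HasDerivAt f₁ (f₂ x) x) (hc : Continuous f₂) (x : ℝ) :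
    f x = f 0 + f₁ 0 * x + ∫ u in (0 : ℝ)..x, (x - u) * f₂ u := by
  have hd : ∀ u, HasDerivAt (fun u => f u + (x - u) * f₁ u) ((x - u) * f₂ u) u := fun u =>
    ((h₁ u).add (((hasDerivAt_id u).const_sub x).mul (h₂ u))).congr_deriv
      (by simp only [id_eq]; ring)
  have hint : IntervalIntegrable (fun u => (x - u) * f₂ u) volume 0 x :=
    (by fun_prop : Continuous fun u => (x - u) * f₂ u).intervalIntegrable 0 x
  rw [intervalIntegral.integral_eq_sub_of_hasDerivAt (fun u _ => hd u) hint]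
  ring

lemma quadratic_le_of_le_second_deriv (h₁ : ∀ x, HasDerivAt f (f₁ x) x)
    (h₂ : ∀ x, HasDerivAt f₁ (f₂ x) x) (hc : Continuous f₂) {c x : ℝ} (hx : 0 ≤ x)
    (hf₂ : ∀ u, 0 ≤ u → c ≤ f₂ u) :
    f 0 + f₁ 0 * x + c / 2 * x ^ 2 ≤ f x := by
  have htaylor := taylor_two_integral_remainder (f := fun u => f u - c / 2 * u ^ 2)
    (fun u => (h₁ u).sub (((hasDerivAt_pow 2 u).const_mul (c / 2)).congr_deriv
      (by simp only [Nat.cast_ofNat, Nat.add_one_sub_one, pow_one]; ring : _ = c * u)))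
    (f₁ := fun u => f₁ u - c * u) (fun u => (h₂ u).sub (hasDerivAt_const_mul c))
    (hc.sub continuous_const) x
  have hrem : 0 ≤ ∫ u in (0 : ℝ)..x, (x - u) * (f₂ u - c) :=
    intervalIntegral.integral_nonneg hx fun u hu =>
      mul_nonneg (sub_nonneg.2 hu.2) (sub_nonneg.2 (hf₂ u hu.1))
  simp only [ne_eq, OfNat.ofNat_ne_zero, not_false_eq_true, zero_pow, mul_zero, sub_zero]
    at htaylor
  linarith

lemma hasDerivAt_add_comp_sub (h : ∀ x, HasDerivAt f (f₁ x) x) (z u : ℝ) :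
    HasDerivAt (fun u => f (z + u) + f (z - u)) (f₁ (z + u) - f₁ (z - u)) u :=
  ((h (z + u)).comp_const_add z u).add ((h (z - u)).comp_const_sub z u)

lemma hasDerivAt_sub_comp_sub (h : ∀ x, HasDerivAt f (f₁ x) x) (z u : ℝ) :
    HasDerivAt (fun u => f (z + u) - f (z - u)) (f₁ (z + u) + f₁ (z - u)) u :=
  (((h (z + u)).comp_const_add z u).sub ((h (z - u)).comp_const_sub z u)).congr_deriv
    (sub_neg_eq_add _ _)

lemma two_mul_add_mul_sq_le_of_convexOn (h₁ : ∀ x, HasDerivAt f (f₁ x) x)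
    (h₂ : ∀ x, HasDerivAt f₁ (f₂ x) x) (hc : Continuous f₂) (hconv : ConvexOn ℝ Set.univ f₂)
    (z : ℝ) {y : ℝ} (hy : 0 ≤ y) :
    2 * f z + f₂ z * y ^ 2 ≤ f (z + y) + f (z - y) := by
  have hmid (u : ℝ) : 2 * f₂ z ≤ f₂ (z + u) + f₂ (z - u) := by
    have h := hconv.2 (Set.mem_univ (z + u)) (Set.mem_univ (z - u))
      (by norm_num : (0 : ℝ) ≤ 1 / 2) (by norm_num : (0 : ℝ) ≤ 1 / 2) (by norm_num)
    simp only [smul_eq_mul] at h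
    rw [show 1 / 2 * (z + u) + 1 / 2 * (z - u) = z by ring] at h
    linarith
  have h := quadratic_le_of_le_second_deriv (hasDerivAt_add_comp_sub h₁ z)
    (hasDerivAt_sub_comp_sub h₂ z) (by fun_prop) hy fun u _ => hmid u
  simp only [add_zero, sub_zero, sub_self, zero_mul] at h
  linarith

end Calculus

section SubmultiplicativeTails

open scoped ENNReal

lemma lintegral_mul_lconvolution_le {h f g : ℝ → ℝ≥0∞} (hh : Measurable h) (hf : Measurable f)
    (hg : Measurable g) (hsub : ∀ s t, f s ≠ 0 → g t ≠ 0 → h (s + t) ≤ h s * h t) :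
    ∫⁻ t, h t * (f ⋆ₗ g) t ≤ (∫⁻ t, h t * f t) * ∫⁻ t, h t * g t := by
  have hpt (s t : ℝ) : h (s + t) * (f s * g t) ≤ (h s * f s) * (h t * g t) := by
    by_cases hs : f s = 0
    · simp [hs]
    by_cases ht : g t = 0
    · simp [ht]
    calc h (s + t) * (f s * g t) ≤ h s * h t * (f s * g t) := by gcongr; exact hsub s t hs ht
      _ = (h s * f s) * (h t * g t) := by ring
  calc ∫⁻ t, h t * (f ⋆ₗ g) t
      = ∫⁻ t, ∫⁻ s, h t * (f s * g (-s + t)) := by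
        refine lintegral_congr fun t => ?_
        rw [lconvolution_def, lintegral_const_mul _ (by fun_prop)]
    _ = ∫⁻ s, ∫⁻ t, h t * (f s * g (-s + t)) := lintegral_lintegral_swap (by fun_prop)
    _ = ∫⁻ s, ∫⁻ t, h (s + t) * (f s * g t) := by
        refine lintegral_congr fun s => ?_
        rw [← lintegral_add_left_eq_self _ s]
        simp only [neg_add_cancel_left]
    _ ≤ ∫⁻ s, ∫⁻ t, (h s * f s) * (h t * g t) :=
        lintegral_mono fun s => lintegral_mono fun t => hpt s t
    _ = (∫⁻ t, h t * f t) * ∫⁻ t, h t * g t := lintegral_lintegral_mul (by fun_prop) (by fun_prop)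

variable {Ω : Type*} [MeasurableSpace Ω] {P : Measure Ω} [IsProbabilityMeasure P] {T : Ω → ℝ}

lemma lintegral_comp_eq_add_lintegral_meas_le_mul (hT : AEMeasurable T P) (hT0 : ∀ ω, 0 ≤ T ω)
    {G g : ℝ → ℝ} (hG : ∀ x, HasDerivAt G (g x) x) (hc : Continuous g)
    (hG0 : 0 ≤ G 0) (hg : ∀ t, 0 ≤ t → 0 ≤ g t) :
    ∫⁻ ω, ENNReal.ofReal (G (T ω)) ∂P = ENNReal.ofReal (G 0)
      + ∫⁻ t in Set.Ioi 0, P {ω | t ≤ T ω} * ENNReal.ofReal (g t) := by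
  have hint (x : ℝ) : ∫ t in (0 : ℝ)..x, g t = G x - G 0 :=
    intervalIntegral.integral_eq_sub_of_hasDerivAt (fun t _ => hG t) (hc.intervalIntegrable 0 x)
  have hsplit (ω : Ω) : ENNReal.ofReal (G (T ω))
      = ENNReal.ofReal (G 0) + ENNReal.ofReal (∫ t in (0 : ℝ)..T ω, g t) := by
    rw [← ENNReal.ofReal_add hG0
      (intervalIntegral.integral_nonneg (hT0 ω) fun t ht => hg t ht.1), hint, add_sub_cancel]
  simp only [hsplit]
  rw [lintegral_add_left measurable_const, lintegral_const, measure_univ, mul_one,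
    lintegral_comp_eq_lintegral_meas_le_mul P (ae_of_all _ hT0) hT
      (fun t _ => hc.intervalIntegrable 0 t)
      ((ae_restrict_mem measurableSet_Ioi).mono fun t ht => hg t (le_of_lt ht))]

lemma ofReal_integral_sub_mul_eq_lconvolution {g : ℝ → ℝ} (hc : Continuous g)
    (hg : ∀ t, 0 ≤ t → 0 ≤ g t) {x : ℝ} (hx : 0 ≤ x) :
    ENNReal.ofReal (∫ u in (0 : ℝ)..x, (x - u) * g u)
      = ((Set.Ioi 0).indicator (fun u => ENNReal.ofReal (g u)) ⋆ₗ ENNReal.ofReal) x := by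
  rw [intervalIntegral.integral_of_le hx, ofReal_integral_eq_lintegral_ofReal
      ((by fun_prop : Continuous fun u => (x - u) * g u).integrableOn_Ioc)
      ((ae_restrict_mem measurableSet_Ioc).mono fun u hu =>
        mul_nonneg (sub_nonneg.2 hu.2) (hg u hu.1.le)),
    lconvolution_def, ← lintegral_indicator measurableSet_Ioc]
  refine lintegral_congr fun u => ?_
  by_cases hu : 0 < u
  · rw [Set.indicator_of_mem (Set.mem_Ioi.2 hu), neg_add_eq_sub, mul_comm]
    by_cases hux : u ≤ x
    · rw [Set.indicator_of_mem (Set.mem_Ioc.2 ⟨hu, hux⟩), ENNReal.ofReal_mul (sub_nonneg.2 hux)]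
    · rw [Set.indicator_of_notMem fun h => hux h.2, ENNReal.ofReal_of_nonpos (by linarith),
        zero_mul]
  · rw [Set.indicator_of_notMem fun h => hu h.1,
      Set.indicator_of_notMem (show u ∉ Set.Ioi 0 from hu), zero_mul]

lemma setLIntegral_mul_lconvolution_ofReal_le {h g : ℝ → ℝ≥0∞} (hh : Measurable h)
    (hg : Measurable g) (hsub : ∀ ⦃s t : ℝ⦄, 0 ≤ s → 0 ≤ t → h (s + t) ≤ h s * h t) :
    ∫⁻ t in Set.Ioi 0, h t * ((Set.Ioi 0).indicator g ⋆ₗ ENNReal.ofReal) t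
      ≤ (∫⁻ t in Set.Ioi 0, h t * g t) * ∫⁻ t in Set.Ioi 0, h t * ENNReal.ofReal t := by
  refine (setLIntegral_le_lintegral _ _).trans <|
    (lintegral_mul_lconvolution_le hh (hg.indicator measurableSet_Ioi) ENNReal.measurable_ofReal
      fun s t hs ht => hsub (le_of_lt (Set.mem_of_indicator_ne_zero hs))
        (ENNReal.ofReal_pos.1 (pos_iff_ne_zero.2 ht)).le).trans_eq ?_
  rw [← lintegral_indicator measurableSet_Ioi, ← lintegral_indicator measurableSet_Ioi]
  congr 2 with t <;> by_cases ht : t ∈ Set.Ioi (0 : ℝ)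
  · simp [ht]
  · simp [ht]
  · simp [ht]
  · simp [ht, ENNReal.ofReal_of_nonpos (not_lt.1 ht)]

lemma lintegral_comp_le_of_submultiplicative (hT : AEMeasurable T P) (hT0 : ∀ ω, 0 ≤ T ω)
    (hsub : ∀ ⦃s t : ℝ⦄, 0 ≤ s → 0 ≤ t →
      P {ω | s + t ≤ T ω} ≤ P {ω | s ≤ T ω} * P {ω | t ≤ T ω})
    {G G₁ G₂ G₃ : ℝ → ℝ} (h₁ : ∀ x, HasDerivAt G (G₁ x) x)
    (h₂ : ∀ x, HasDerivAt G₁ (G₂ x) x) (h₃ : ∀ x, HasDerivAt G₂ (G₃ x) x)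
    (hc : Continuous G₃) (hG : 0 ≤ G 0) (hG₁ : G₁ 0 = 0) (hG₂ : 0 ≤ G₂ 0)
    (hG₃ : ∀ u, 0 ≤ u → 0 ≤ G₃ u) :
    ∫⁻ ω, ENNReal.ofReal (G (T ω)) ∂P ≤ ENNReal.ofReal (G 0)
      + (∫⁻ ω, ENNReal.ofReal (T ω ^ 2 / 2) ∂P) * ∫⁻ ω, ENNReal.ofReal (G₂ (T ω)) ∂P := by
  set h : ℝ → ℝ≥0∞ := fun t => P {ω | t ≤ T ω}
  set g : ℝ → ℝ≥0∞ := (Set.Ioi 0).indicator fun u => ENNReal.ofReal (G₃ u)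
  have hh : Measurable h :=
    Antitone.measurable fun s t hst => measure_mono fun ω (hω : t ≤ T ω) => hst.trans hω
  have : Measurable g := hc.measurable.ennreal_ofReal.indicator measurableSet_Ioi
  have hsq : ∫⁻ ω, ENNReal.ofReal (T ω ^ 2 / 2) ∂P
      = ∫⁻ t in Set.Ioi 0, h t * ENNReal.ofReal t := by
    simpa using lintegral_comp_eq_add_lintegral_meas_le_mul hT hT0 (G := fun t => t ^ 2 / 2)
      (g := fun t => t) (fun x => ((hasDerivAt_pow 2 x).div_const 2).congr_deriv (by simp))
      continuous_id (by simp) (fun t ht => ht)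
  have hG₁_eq {t : ℝ} (ht : 0 ≤ t) : 0 ≤ G₁ t ∧ ENNReal.ofReal (G₁ t)
      = ENNReal.ofReal (G₂ 0) * ENNReal.ofReal t + (g ⋆ₗ ENNReal.ofReal) t := by
    have hrem : 0 ≤ ∫ u in (0 : ℝ)..t, (t - u) * G₃ u :=
      intervalIntegral.integral_nonneg ht fun u hu => mul_nonneg (sub_nonneg.2 hu.2) (hG₃ u hu.1)
    rw [taylor_two_integral_remainder h₂ h₃ hc t, hG₁, zero_add,
      ENNReal.ofReal_add (mul_nonneg hG₂ ht) hrem, ENNReal.ofReal_mul hG₂,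
      ofReal_integral_sub_mul_eq_lconvolution hc hG₃ ht]
    exact ⟨add_nonneg (mul_nonneg hG₂ ht) hrem, rfl⟩
  have hG₁_cont : Continuous G₁ := continuous_iff_continuousAt.2 fun x => (h₂ x).continuousAt
  rw [lintegral_comp_eq_add_lintegral_meas_le_mul hT hT0 h₁ hG₁_cont hG fun t ht => (hG₁_eq ht).1,
    lintegral_comp_eq_add_lintegral_meas_le_mul hT hT0 h₃ hc hG₂ hG₃, hsq]
  gcongr
  calc ∫⁻ t in Set.Ioi 0, h t * ENNReal.ofReal (G₁ t)
      = ∫⁻ t in Set.Ioi 0, ENNReal.ofReal (G₂ 0) * (h t * ENNReal.ofReal t)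
          + h t * (g ⋆ₗ ENNReal.ofReal) t :=
        setLIntegral_congr_fun measurableSet_Ioi fun t ht => by
          simp only [(hG₁_eq (le_of_lt ht)).2]; ring
    _ = ENNReal.ofReal (G₂ 0) * (∫⁻ t in Set.Ioi 0, h t * ENNReal.ofReal t)
          + ∫⁻ t in Set.Ioi 0, h t * (g ⋆ₗ ENNReal.ofReal) t := by
        rw [lintegral_add_left (by fun_prop), lintegral_const_mul _ (by fun_prop)]
    _ ≤ _ := by
        rw [mul_add, mul_comm (ENNReal.ofReal (G₂ 0))]
        gcongr
        rw [mul_comm]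
        exact setLIntegral_mul_lconvolution_ofReal_le hh hc.measurable.ennreal_ofReal hsub

end SubmultiplicativeTails

section Symmetrization

variable {Ω : Type*} [MeasurableSpace Ω] {P : Measure Ω} {Y : Ω → ℝ}

lemma IsSymmetricRV.two_mul_lintegral_comp (hY : IsSymmetricRV Y P) {F : ℝ → ENNReal}
    (hF : Measurable F) :
    2 * ∫⁻ ω, F (Y ω) ∂P = ∫⁻ ω, F |Y ω| + F (-|Y ω|) ∂P := by
  have hflip : ∫⁻ ω, F (Y ω) ∂P = ∫⁻ ω, F (-Y ω) ∂P := (hY.comp hF).lintegral_eq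
  have hm : AEMeasurable Y P := hY.aemeasurable_fst
  calc 2 * ∫⁻ ω, F (Y ω) ∂P = ∫⁻ ω, F (Y ω) + F (-Y ω) ∂P := by
        rw [lintegral_add_left' (by fun_prop), ← hflip, two_mul]
    _ = ∫⁻ ω, F |Y ω| + F (-|Y ω|) ∂P := lintegral_congr fun ω => by
        rcases abs_choice (Y ω) with h | h <;> rw [h]
        rw [neg_neg, add_comm]

lemma IsSymmetricRV.two_mul_lintegral_comp_add (hY : IsSymmetricRV Y P) {F : ℝ → ℝ}
    (hF : Measurable F) (hF0 : ∀ x, 0 ≤ F x) (z : ℝ) :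
    2 * ∫⁻ ω, ENNReal.ofReal (F (z + Y ω)) ∂P
      = ∫⁻ ω, ENNReal.ofReal (F (z + |Y ω|) + F (z - |Y ω|)) ∂P := by
  rw [hY.two_mul_lintegral_comp (F := fun y => ENNReal.ofReal (F (z + y))) (by fun_prop)]
  simp only [ENNReal.ofReal_add (hF0 _) (hF0 _), sub_eq_add_neg]

lemma IsSymmetricRV.integral_eq_zero (hY : IsSymmetricRV Y P) : ∫ ω, Y ω ∂P = 0 := by
  have h : ∫ ω, Y ω ∂P = ∫ ω, -Y ω ∂P := hY.integral_eq
  rw [integral_neg] at h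
  linarith

lemma IsSymmetricRV.variance_eq (hY : IsSymmetricRV Y P) : Var[Y; P] = ∫ ω, Y ω ^ 2 ∂P :=
  variance_of_integral_eq_zero hY.aemeasurable_fst hY.integral_eq_zero

end Symmetrization

/-- A symmetric square-integrable random variable `Y` such that `|Y|` is new better than used:
its tail `t ↦ P(|Y| ≥ t)` is submultiplicative. This is all that the argument needs from
logarithmically concave tails. -/
structure IsSymmetricNBU {Ω : Type*} [MeasurableSpace Ω] (Y : Ω → ℝ) (P : Measure Ω) : Prop where
  symm : IsSymmetricRV Y P
  memLp_two : MemLp Y 2 P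
  measure_add_le : ∀ ⦃s t : ℝ⦄, 0 ≤ s → 0 ≤ t →
    P {ω | s + t ≤ |Y ω|} ≤ P {ω | s ≤ |Y ω|} * P {ω | t ≤ |Y ω|}

namespace IsSymmetricNBU

variable {Ω : Type*} [MeasurableSpace Ω] {P : Measure Ω} {Y : Ω → ℝ}

lemma aemeasurable (hY : IsSymmetricNBU Y P) : AEMeasurable Y P := hY.symm.aemeasurable_fst

lemma lintegral_sq_div_two (hY : IsSymmetricNBU Y P) :
    ∫⁻ ω, ENNReal.ofReal (|Y ω| ^ 2 / 2) ∂P = ENNReal.ofReal (Var[Y; P] / 2) := by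
  rw [hY.symm.variance_eq, ← integral_div, ofReal_integral_eq_lintegral_ofReal
    (hY.memLp_two.integrable_sq.div_const 2) (ae_of_all _ fun ω => by positivity)]
  simp only [sq_abs]

section SecondOrder

variable [IsProbabilityMeasure P] {F F₁ F₂ F₃ : ℝ → ℝ}

lemma lintegral_comp_add_le (hY : IsSymmetricNBU Y P) (h₁ : ∀ x, HasDerivAt F (F₁ x) x)
    (h₂ : ∀ x, HasDerivAt F₁ (F₂ x) x) (h₃ : ∀ x, HasDerivAt F₂ (F₃ x) x)
    (hc : Continuous F₃) (hmono : Monotone F₃) (hF : ∀ x, 0 ≤ F x) (hF₂ : ∀ x, 0 ≤ F₂ x) (z : ℝ) :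
    ∫⁻ ω, ENNReal.ofReal (F (z + Y ω)) ∂P ≤ ENNReal.ofReal (F z)
      + ENNReal.ofReal (Var[Y; P] / 2) * ∫⁻ ω, ENNReal.ofReal (F₂ (z + Y ω)) ∂P := by
  have hF_cont : Continuous F := continuous_iff_continuousAt.2 fun x => (h₁ x).continuousAt
  have hF₂_cont : Continuous F₂ := continuous_iff_continuousAt.2 fun x => (h₃ x).continuousAt
  have key := lintegral_comp_le_of_submultiplicative hY.aemeasurable.abs (fun ω => abs_nonneg _)
    hY.measure_add_le (hasDerivAt_add_comp_sub h₁ z) (hasDerivAt_sub_comp_sub h₂ z)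
    (hasDerivAt_add_comp_sub h₃ z) (by fun_prop) (add_nonneg (hF _) (hF _)) (by simp)
    (add_nonneg (hF₂ _) (hF₂ _)) (fun u hu => sub_nonneg.2 (hmono (by linarith)))
  rw [← hY.symm.two_mul_lintegral_comp_add hF_cont.measurable hF,
    ← hY.symm.two_mul_lintegral_comp_add hF₂_cont.measurable hF₂, hY.lintegral_sq_div_two,
    add_zero, sub_zero, ENNReal.ofReal_add (hF z) (hF z), ← two_mul, mul_left_comm,
    ← mul_add] at key
  exact (ENNReal.mul_le_mul_iff_right two_ne_zero ENNReal.ofNat_ne_top).1 key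

lemma le_lintegral_comp_add (hY : IsSymmetricNBU Y P) (h₁ : ∀ x, HasDerivAt F (F₁ x) x)
    (h₂ : ∀ x, HasDerivAt F₁ (F₂ x) x) (hc : Continuous F₂) (hconv : ConvexOn ℝ Set.univ F₂)
    (hF : ∀ x, 0 ≤ F x) {z : ℝ} (hF₂ : 0 ≤ F₂ z) :
    ENNReal.ofReal (F z) + ENNReal.ofReal (Var[Y; P] / 2) * ENNReal.ofReal (F₂ z)
      ≤ ∫⁻ ω, ENNReal.ofReal (F (z + Y ω)) ∂P := by
  have hF_cont : Continuous F := continuous_iff_continuousAt.2 fun x => (h₁ x).continuousAt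
  have : AEMeasurable Y P := hY.aemeasurable
  refine (ENNReal.mul_le_mul_iff_right two_ne_zero ENNReal.ofNat_ne_top).1 ?_
  calc 2 * (ENNReal.ofReal (F z) + ENNReal.ofReal (Var[Y; P] / 2) * ENNReal.ofReal (F₂ z))
      = ∫⁻ ω, ENNReal.ofReal (2 * F z) + ENNReal.ofReal (2 * F₂ z)
          * ENNReal.ofReal (|Y ω| ^ 2 / 2) ∂P := by
        rw [lintegral_add_left measurable_const, lintegral_const, measure_univ, mul_one,
          lintegral_const_mul' _ _ ENNReal.ofReal_ne_top, hY.lintegral_sq_div_two,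
          ENNReal.ofReal_mul zero_le_two, ENNReal.ofReal_mul zero_le_two, ENNReal.ofReal_ofNat]
        ring
    _ ≤ ∫⁻ ω, ENNReal.ofReal (F (z + |Y ω|) + F (z - |Y ω|)) ∂P := by
        refine lintegral_mono fun ω => ?_
        rw [← ENNReal.ofReal_mul (by positivity),
          ← ENNReal.ofReal_add (mul_nonneg zero_le_two (hF z)) (by positivity)]
        refine ENNReal.ofReal_le_ofReal ?_
        have := two_mul_add_mul_sq_le_of_convexOn h₁ h₂ hc hconv z (abs_nonneg (Y ω))
        linarith
    _ = 2 * ∫⁻ ω, ENNReal.ofReal (F (z + Y ω)) ∂P :=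
        (hY.symm.two_mul_lintegral_comp_add hF_cont.measurable hF z).symm

end SecondOrder

end IsSymmetricNBU

section AbsRpow

lemma hasDerivAt_abs_rpow_mul_self {q : ℝ} (hq : 1 < q) (x : ℝ) :
    HasDerivAt (fun x : ℝ => |x| ^ q * x) ((q + 1) * |x| ^ q) x := by
  refine ((hasDerivAt_abs_rpow x hq).mul (hasDerivAt_id x)).congr_deriv ?_
  have hsq : |x| ^ (q - 2) * x ^ 2 = |x| ^ q := by
    rcases eq_or_ne x 0 with rfl | hx
    · simp [Real.zero_rpow (by linarith : q ≠ 0)]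
    · rw [← sq_abs, ← Real.rpow_two, ← Real.rpow_add (abs_pos.2 hx), sub_add_cancel]
  simp only [id_eq]
  linear_combination q * hsq

lemma monotone_abs_rpow_mul_self {q : ℝ} (hq : 0 ≤ q) : Monotone fun x : ℝ => |x| ^ q * x := by
  refine monotone_of_odd_of_monotoneOn_nonneg (fun x => by rw [abs_neg]; ring) ?_
  intro x (hx : 0 ≤ x) y (hy : 0 ≤ y) hxy
  simp only [abs_of_nonneg hx, abs_of_nonneg hy]
  gcongr

lemma convexOn_abs_rpow {q : ℝ} (hq : 1 ≤ q) : ConvexOn ℝ Set.univ fun x : ℝ => |x| ^ q := by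
  refine ⟨convex_univ, fun x _ y _ a b ha hb hab => ?_⟩
  calc |a • x + b • y| ^ q ≤ (a • |x| + b • |y|) ^ q := by
        gcongr
        simpa only [smul_eq_mul, abs_mul, abs_of_nonneg ha, abs_of_nonneg hb]
          using abs_add_le (a * x) (b * y)
    _ ≤ a • |x| ^ q + b • |y| ^ q := (convexOn_rpow hq).2 (abs_nonneg x) (abs_nonneg y) ha hb hab

lemma hasDerivAt_deriv_abs_rpow {p : ℝ} (hp : 3 < p) (x : ℝ) :
    HasDerivAt (fun x : ℝ => p * |x| ^ (p - 2) * x) (p * (p - 1) * |x| ^ (p - 2)) x := by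
  simpa only [mul_assoc] using ((hasDerivAt_abs_rpow_mul_self (by linarith : 1 < p - 2) x).const_mul
    p).congr_deriv (by ring)

variable {Ω : Type*} [MeasurableSpace Ω] {P : Measure Ω} {S : Ω → ℝ} {p : ℝ}

lemma memLp_ofReal_iff (hS : AEMeasurable S P) (hp : 0 < p) :
    MemLp S (ENNReal.ofReal p) P ↔ ∫⁻ ω, ENNReal.ofReal (|S ω| ^ p) ∂P < ⊤ := by
  rw [MemLp, and_iff_right hS.aestronglyMeasurable, eLpNorm_lt_top_iff_lintegral_rpow_enorm_lt_top
    (ENNReal.ofReal_pos.2 hp).ne' ENNReal.ofReal_ne_top, ENNReal.toReal_ofReal hp.le]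
  simp only [Real.enorm_eq_ofReal_abs, ENNReal.ofReal_rpow_of_nonneg (abs_nonneg _) hp.le]

lemma integrable_abs_rpow_of_memLp (hp : 0 < p) (hS : MemLp S (ENNReal.ofReal p) P) :
    Integrable (fun ω => |S ω| ^ p) P := by
  simpa only [Real.norm_eq_abs, ENNReal.toReal_ofReal hp.le] using
    hS.integrable_norm_rpow (ENNReal.ofReal_pos.2 hp).ne' ENNReal.ofReal_ne_top

lemma ofReal_integral_abs_rpow (hp : 0 < p) (hS : MemLp S (ENNReal.ofReal p) P) :
    ENNReal.ofReal (∫ ω, |S ω| ^ p ∂P) = ∫⁻ ω, ENNReal.ofReal (|S ω| ^ p) ∂P :=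
  ofReal_integral_eq_lintegral_ofReal (integrable_abs_rpow_of_memLp hp hS)
    (ae_of_all _ fun ω => by positivity)

lemma lintegral_comp_add_of_indepFun [IsFiniteMeasure P] {Z Y : Ω → ℝ} (hZ : AEMeasurable Z P)
    (hY : AEMeasurable Y P) (h : IndepFun Z Y P) {F : ℝ → ENNReal} (hF : Measurable F) :
    ∫⁻ ω, F (Z ω + Y ω) ∂P = ∫⁻ ω, ∫⁻ ω', F (Z ω + Y ω') ∂P ∂P := by
  calc ∫⁻ ω, F (Z ω + Y ω) ∂P = ∫⁻ x, F x ∂(P.map (Z + Y)) :=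
        (lintegral_map' hF.aemeasurable (hZ.add hY)).symm
    _ = ∫⁻ z, ∫⁻ y, F (z + y) ∂(P.map Y) ∂(P.map Z) := by
        rw [h.map_add_eq_map_conv_map₀ hZ hY, Measure.lintegral_conv hF]
    _ = ∫⁻ ω, ∫⁻ y, F (Z ω + y) ∂(P.map Y) ∂P :=
        lintegral_map' (Measurable.lintegral_prod_right (by fun_prop)).aemeasurable hZ
    _ = ∫⁻ ω, ∫⁻ ω', F (Z ω + Y ω') ∂P ∂P :=
        lintegral_congr fun ω => lintegral_map' (by fun_prop) hY

end AbsRpow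

namespace IsSymmetricNBU

variable {Ω : Type*} [MeasurableSpace Ω] {P : Measure Ω} [IsProbabilityMeasure P] {Y : Ω → ℝ}
  {p : ℝ}

lemma lintegral_abs_add_rpow_le (hY : IsSymmetricNBU Y P) (hp : 4 ≤ p) (z : ℝ) :
    ∫⁻ ω, ENNReal.ofReal (|z + Y ω| ^ p) ∂P ≤ ENNReal.ofReal (|z| ^ p)
      + ENNReal.ofReal (p * (p - 1) / 2 * Var[Y; P])
        * ∫⁻ ω, ENNReal.ofReal (|z + Y ω| ^ (p - 2)) ∂P := by
  have hp₁ : 0 ≤ p * (p - 1) := mul_nonneg (by linarith) (by linarith)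
  have h₃ (x : ℝ) : HasDerivAt (fun x => p * (p - 1) * |x| ^ (p - 2))
      (p * (p - 1) * (p - 2) * (|x| ^ (p - 4) * x)) x :=
    ((hasDerivAt_abs_rpow x (by linarith : 1 < p - 2)).const_mul _).congr_deriv (by
      rw [show p - 2 - 2 = p - 4 by ring]; ring)
  have hcont : Continuous fun x : ℝ => |x| ^ (p - 4) :=
    continuous_abs.rpow_const fun _ => Or.inr (by linarith)
  have h := hY.lintegral_comp_add_le (fun x => hasDerivAt_abs_rpow x (by linarith))
    (hasDerivAt_deriv_abs_rpow (by linarith)) h₃ (by fun_prop)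
    ((monotone_abs_rpow_mul_self (by linarith : 0 ≤ p - 4)).const_mul
      (mul_nonneg hp₁ (by linarith)))
    (fun x => by positivity) (fun x => by positivity) z
  simp only [ENNReal.ofReal_mul hp₁] at h
  rwa [lintegral_const_mul' _ _ ENNReal.ofReal_ne_top, ← mul_assoc,
    ← ENNReal.ofReal_mul (div_nonneg (variance_nonneg Y P) zero_le_two),
    show Var[Y; P] / 2 * (p * (p - 1)) = p * (p - 1) / 2 * Var[Y; P] by ring] at h

lemma le_lintegral_abs_add_rpow (hY : IsSymmetricNBU Y P) (hp : 3 < p) (z : ℝ) :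
    ENNReal.ofReal (|z| ^ p)
        + ENNReal.ofReal (p * (p - 1) / 2 * Var[Y; P]) * ENNReal.ofReal (|z| ^ (p - 2))
      ≤ ∫⁻ ω, ENNReal.ofReal (|z + Y ω| ^ p) ∂P := by
  have hp₁ : 0 ≤ p * (p - 1) := mul_nonneg (by linarith) (by linarith)
  have hcont : Continuous fun x : ℝ => |x| ^ (p - 2) :=
    continuous_abs.rpow_const fun _ => Or.inr (by linarith)
  have h := hY.le_lintegral_comp_add (fun x => hasDerivAt_abs_rpow x (by linarith))
    (hasDerivAt_deriv_abs_rpow hp) (by fun_prop)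
    ((convexOn_abs_rpow (by linarith : 1 ≤ p - 2)).smul hp₁)
    (fun x => by positivity) (by positivity : 0 ≤ p * (p - 1) * |z| ^ (p - 2))
  rwa [ENNReal.ofReal_mul hp₁, ← mul_assoc,
    ← ENNReal.ofReal_mul (div_nonneg (variance_nonneg Y P) zero_le_two),
    show Var[Y; P] / 2 * (p * (p - 1)) = p * (p - 1) / 2 * Var[Y; P] by ring] at h

protected lemma memLp (hY : IsSymmetricNBU Y P) (p : ℝ) : MemLp Y (ENNReal.ofReal p) P := by
  have heven (k : ℕ) : MemLp Y (ENNReal.ofReal (2 * k + 2)) P := by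
    induction k with
    | zero => simpa using hY.memLp_two
    | succ k ih =>
      have hk : (0 : ℝ) ≤ k := k.cast_nonneg
      have hstep := hY.lintegral_abs_add_rpow_le (p := 2 * (k + 1 : ℕ) + 2)
        (by push_cast; linarith) 0
      simp only [zero_add, show (2 * (k + 1 : ℕ) + 2 - 2 : ℝ) = 2 * k + 2 by push_cast; ring]
        at hstep
      rw [memLp_ofReal_iff hY.aemeasurable (by positivity)] at ih ⊢
      exact hstep.trans_lt (ENNReal.add_lt_top.2
        ⟨ENNReal.ofReal_lt_top, ENNReal.mul_lt_top ENNReal.ofReal_lt_top ih⟩)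
  obtain ⟨k, hk⟩ := exists_nat_ge p
  exact (heven k).mono_exponent (ENNReal.ofReal_le_ofReal (by linarith [k.cast_nonneg (α := ℝ)]))

section IndependentSum

variable {Z : Ω → ℝ}

lemma integral_abs_add_rpow_le (hY : IsSymmetricNBU Y P) (hZ : MemLp Z (ENNReal.ofReal p) P)
    (h : IndepFun Z Y P) (hp : 4 ≤ p) :
    ∫ ω, |Z ω + Y ω| ^ p ∂P ≤ ∫ ω, |Z ω| ^ p ∂P
      + p * (p - 1) / 2 * Var[Y; P] * ∫ ω, |Z ω + Y ω| ^ (p - 2) ∂P := by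
  have hc : 0 ≤ p * (p - 1) / 2 * Var[Y; P] :=
    mul_nonneg (div_nonneg (mul_nonneg (by linarith) (by linarith)) zero_le_two)
      (variance_nonneg Y P)
  have hZY : MemLp (fun ω => Z ω + Y ω) (ENNReal.ofReal p) P := hZ.add (hY.memLp p)
  have hZY' := hZY.mono_exponent (ENNReal.ofReal_le_ofReal (by linarith : p - 2 ≤ p))
  have hmZ : AEMeasurable Z P := hZ.aestronglyMeasurable.aemeasurable
  rw [← ENNReal.ofReal_le_ofReal_iff (by positivity), ENNReal.ofReal_add (by positivity)
    (by positivity), ENNReal.ofReal_mul hc, ofReal_integral_abs_rpow (by linarith) hZY,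
    ofReal_integral_abs_rpow (by linarith) hZ, ofReal_integral_abs_rpow (by linarith) hZY',
    lintegral_comp_add_of_indepFun hmZ hY.aemeasurable h
      (F := fun x => ENNReal.ofReal (|x| ^ p)) (by fun_prop),
    lintegral_comp_add_of_indepFun hmZ hY.aemeasurable h
      (F := fun x => ENNReal.ofReal (|x| ^ (p - 2))) (by fun_prop),
    ← lintegral_const_mul' _ _ ENNReal.ofReal_ne_top, ← lintegral_add_left' (by fun_prop)]
  exact lintegral_mono fun ω => hY.lintegral_abs_add_rpow_le hp (Z ω)

lemma le_integral_abs_add_rpow (hY : IsSymmetricNBU Y P) (hZ : MemLp Z (ENNReal.ofReal p) P)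
    (h : IndepFun Z Y P) (hp : 3 < p) :
    ∫ ω, |Z ω| ^ p ∂P + p * (p - 1) / 2 * Var[Y; P] * ∫ ω, |Z ω| ^ (p - 2) ∂P
      ≤ ∫ ω, |Z ω + Y ω| ^ p ∂P := by
  have hc : 0 ≤ p * (p - 1) / 2 * Var[Y; P] :=
    mul_nonneg (div_nonneg (mul_nonneg (by linarith) (by linarith)) zero_le_two)
      (variance_nonneg Y P)
  have hZY : MemLp (fun ω => Z ω + Y ω) (ENNReal.ofReal p) P := hZ.add (hY.memLp p)
  have hZ' := hZ.mono_exponent (ENNReal.ofReal_le_ofReal (by linarith : p - 2 ≤ p))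
  have hmZ : AEMeasurable Z P := hZ.aestronglyMeasurable.aemeasurable
  rw [← ENNReal.ofReal_le_ofReal_iff (by positivity), ENNReal.ofReal_add (by positivity)
    (by positivity), ENNReal.ofReal_mul hc, ofReal_integral_abs_rpow (by linarith) hZY,
    ofReal_integral_abs_rpow (by linarith) hZ, ofReal_integral_abs_rpow (by linarith) hZ',
    lintegral_comp_add_of_indepFun hmZ hY.aemeasurable h
      (F := fun x => ENNReal.ofReal (|x| ^ p)) (by fun_prop),
    ← lintegral_const_mul' _ _ ENNReal.ofReal_ne_top, ← lintegral_add_left' (by fun_prop)]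
  exact lintegral_mono fun ω => hY.le_lintegral_abs_add_rpow hp (Z ω)

end IndependentSum

lemma integral_pow_four_le (hY : IsSymmetricNBU Y P) : ∫ ω, Y ω ^ 4 ∂P ≤ 6 * Var[Y; P] ^ 2 := by
  have h := hY.integral_abs_add_rpow_le (Z := fun _ => 0) (memLp_const 0)
    (indepFun_const_left 0 Y) le_rfl
  norm_num [hY.symm.variance_eq, (by decide : Even 4).pow_abs] at h ⊢
  linarith

end IsSymmetricNBU

section CosRemainder

/-- The remainder `cos u - 1 + u² / 2` of the second order Taylor expansion of the cosine. For
`2 < p < 4` the power `|x| ^ p` is proportional to `∫ t ^ (-p - 1) * cosRemainder (t * x)` over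
`t > 0`, which expresses absolute moments through characteristic functions. -/
noncomputable def cosRemainder (u : ℝ) : ℝ := Real.cos u - 1 + u ^ 2 / 2

lemma cosRemainder_nonneg (u : ℝ) : 0 ≤ cosRemainder u := by
  unfold cosRemainder
  linarith [Real.one_sub_sq_div_two_le_cos (x := u)]

lemma cosRemainder_le_sq (u : ℝ) : cosRemainder u ≤ u ^ 2 := by
  unfold cosRemainder
  linarith [Real.cos_le_one u, sq_nonneg u]

lemma cosRemainder_le_pow_four_div (u : ℝ) : cosRemainder u ≤ u ^ 4 / 24 := by
  have h₁ (x : ℝ) : HasDerivAt (fun x => x ^ 4 / 24 - Real.cos x) (x ^ 3 / 6 + Real.sin x) x :=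
    (((hasDerivAt_pow 4 x).div_const 24).sub (Real.hasDerivAt_cos x)).congr_deriv
      (by push_cast; ring)
  have h₂ (x : ℝ) : HasDerivAt (fun x => x ^ 3 / 6 + Real.sin x) (x ^ 2 / 2 + Real.cos x) x :=
    (((hasDerivAt_pow 3 x).div_const 6).add (Real.hasDerivAt_sin x)).congr_deriv
      (by push_cast; ring)
  have h := quadratic_le_of_le_second_deriv (c := 1) h₁ h₂ (by fun_prop) (abs_nonneg u)
    fun x _ => by linarith [Real.one_sub_sq_div_two_le_cos (x := x)]
  simp only [Real.cos_abs, sq_abs, (by decide : Even 4).pow_abs, Real.cos_zero, Real.sin_zero]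
    at h
  unfold cosRemainder
  linarith

lemma cosRemainder_pos_of_two_lt {u : ℝ} (hu : 2 < u) : 0 < cosRemainder u := by
  unfold cosRemainder
  nlinarith [Real.neg_one_le_cos u]

lemma cosRemainder_abs (u : ℝ) : cosRemainder |u| = cosRemainder u := by
  simp only [cosRemainder, Real.cos_abs, sq_abs]

@[fun_prop]
lemma continuous_cosRemainder : Continuous cosRemainder := by
  unfold cosRemainder
  fun_prop

variable {p : ℝ}

lemma integrableOn_rpow_mul_cosRemainder (hp : 2 < p) (hp' : p < 4) (x : ℝ) :
    IntegrableOn (fun t : ℝ => t ^ (-p - 1) * cosRemainder (t * x)) (Set.Ioi 0) := by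
  have hO {k : ℕ} (hk : ∀ u, cosRemainder u ≤ u ^ k) (l : Filter ℝ) :
      (fun t => cosRemainder (t * x)) =O[l] fun t : ℝ => t ^ (-(-k : ℝ)) := by
    refine Asymptotics.IsBigO.of_bound (|x| ^ k) (Filter.Eventually.of_forall fun t => ?_)
    rw [neg_neg, Real.rpow_natCast, norm_pow, Real.norm_eq_abs, Real.norm_eq_abs, ← mul_pow,
      abs_of_nonneg (cosRemainder_nonneg _), ← cosRemainder_abs, abs_mul, mul_comm]
    exact hk _
  have hpow (u : ℝ) : cosRemainder u ≤ u ^ 4 :=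
    (cosRemainder_le_pow_four_div u).trans (div_le_self (by positivity) (by norm_num))
  exact mellin_convergent_of_isBigO_scalar (ContinuousOn.locallyIntegrableOn
    (by fun_prop) measurableSet_Ioi) (hO cosRemainder_le_sq _)
    (by push_cast; linarith)
    (hO hpow _)
    (by push_cast; linarith)

lemma integral_rpow_mul_cosRemainder_pos (hp : 2 < p) (hp' : p < 4) :
    0 < ∫ t in Set.Ioi (0 : ℝ), t ^ (-p - 1) * cosRemainder t := by
  have hint := integrableOn_rpow_mul_cosRemainder hp hp' 1
  simp only [mul_one] at hint
  rw [setIntegral_pos_iff_support_of_nonneg_ae ((ae_restrict_mem measurableSet_Ioi).mono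
    fun t ht => mul_nonneg (Real.rpow_nonneg (le_of_lt ht) _) (cosRemainder_nonneg t)) hint]
  refine lt_of_lt_of_le (by simp : 0 < volume (Set.Ioi (2 : ℝ))) (measure_mono fun t ht => ?_)
  have ht0 : 0 < t := zero_lt_two.trans ht
  exact ⟨(mul_pos (Real.rpow_pos_of_pos ht0 _) (cosRemainder_pos_of_two_lt ht)).ne', ht0⟩

lemma integral_rpow_mul_cosRemainder_mul (hp : 0 < p) (x : ℝ) :
    ∫ t in Set.Ioi (0 : ℝ), t ^ (-p - 1) * cosRemainder (t * x)
      = |x| ^ p * ∫ t in Set.Ioi (0 : ℝ), t ^ (-p - 1) * cosRemainder t := by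
  rcases eq_or_ne x 0 with rfl | hx
  · simp [cosRemainder, Real.zero_rpow hp.ne']
  have hx' : 0 < |x| := abs_pos.2 hx
  have hscale : ∀ t ∈ Set.Ioi (0 : ℝ), t ^ (-p - 1) * cosRemainder (t * x)
      = |x| ^ (p + 1) * ((|x| * t) ^ (-p - 1) * cosRemainder (|x| * t)) := fun t ht => by
    have hpow : |x| ^ (p + 1) * |x| ^ (-p - 1) = 1 := by
      rw [← Real.rpow_add hx', add_add_sub_cancel, add_neg_cancel, Real.rpow_zero]
    rw [Real.mul_rpow hx'.le (le_of_lt ht), ← cosRemainder_abs (t * x), abs_mul,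
      abs_of_pos (show 0 < t from ht), mul_comm t]
    linear_combination (-(cosRemainder (|x| * t) * t ^ (-p - 1))) * hpow
  rw [setIntegral_congr_fun measurableSet_Ioi hscale, integral_const_mul,
    integral_comp_mul_left_Ioi (fun t => t ^ (-p - 1) * cosRemainder t) 0 hx', mul_zero,
    smul_eq_mul, Real.rpow_add hx', Real.rpow_one]
  field_simp

variable {Ω : Type*} [MeasurableSpace Ω] {P : Measure Ω} {S : Ω → ℝ}

lemma lintegral_abs_rpow_mul_integral_cosRemainder [SFinite P] (hS : AEMeasurable S P) (hp : 2 < p)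
    (hp' : p < 4) :
    (∫⁻ ω, ENNReal.ofReal (|S ω| ^ p) ∂P)
        * ENNReal.ofReal (∫ t in Set.Ioi (0 : ℝ), t ^ (-p - 1) * cosRemainder t)
      = ∫⁻ t in Set.Ioi (0 : ℝ), ENNReal.ofReal (t ^ (-p - 1))
        * ∫⁻ ω, ENNReal.ofReal (cosRemainder (t * S ω)) ∂P := by
  have hscale (x : ℝ) : ENNReal.ofReal (|x| ^ p)
        * ENNReal.ofReal (∫ t in Set.Ioi (0 : ℝ), t ^ (-p - 1) * cosRemainder t)
      = ∫⁻ t in Set.Ioi (0 : ℝ), ENNReal.ofReal (t ^ (-p - 1))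
        * ENNReal.ofReal (cosRemainder (t * x)) := by
    rw [← ENNReal.ofReal_mul (by positivity),
      ← integral_rpow_mul_cosRemainder_mul (zero_lt_two.trans hp),
      ofReal_integral_eq_lintegral_ofReal (integrableOn_rpow_mul_cosRemainder hp hp' x)
        ((ae_restrict_mem measurableSet_Ioi).mono fun t ht =>
          mul_nonneg (Real.rpow_nonneg (le_of_lt ht) _) (cosRemainder_nonneg _))]
    simp only [ENNReal.ofReal_mul' (cosRemainder_nonneg _)]
  rw [← lintegral_mul_const' _ _ ENNReal.ofReal_ne_top]
  simp only [hscale]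
  rw [lintegral_lintegral_swap (by unfold Function.uncurry; fun_prop)]
  exact lintegral_congr fun t => lintegral_const_mul' _ _ ENNReal.ofReal_ne_top

lemma integrable_cosRemainder_mul (hS : MemLp S 2 P) (t : ℝ) :
    Integrable (fun ω => cosRemainder (t * S ω)) P := by
  have hm : AEMeasurable S P := hS.aestronglyMeasurable.aemeasurable
  refine (hS.integrable_sq.const_mul (t ^ 2)).mono' (by fun_prop) (ae_of_all _ fun ω => ?_)
  rw [Real.norm_of_nonneg (cosRemainder_nonneg _), ← mul_pow]
  exact cosRemainder_le_sq _

lemma integral_abs_rpow_le_of_integral_cosRemainder_le [IsFiniteMeasure P] {Ω' : Type*}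
    [MeasurableSpace Ω'] {Q : Measure Ω'} [IsFiniteMeasure Q] {T : Ω' → ℝ}
    (hp : 2 < p) (hp' : p < 4)
    (hS : MemLp S (ENNReal.ofReal p) P) (hT : MemLp T (ENNReal.ofReal p) Q)
    (h : ∀ t, ∫ ω, cosRemainder (t * S ω) ∂P ≤ ∫ ω, cosRemainder (t * T ω) ∂Q) :
    ∫ ω, |S ω| ^ p ∂P ≤ ∫ ω, |T ω| ^ p ∂Q := by
  have hp₀ : 0 < p := zero_lt_two.trans hp
  have h₂ : (2 : ENNReal) ≤ ENNReal.ofReal p := by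
    rw [← ENNReal.ofReal_ofNat]
    exact ENNReal.ofReal_le_ofReal hp.le
  have hC : ENNReal.ofReal (∫ t in Set.Ioi (0 : ℝ), t ^ (-p - 1) * cosRemainder t) ≠ 0 :=
    (ENNReal.ofReal_pos.2 (integral_rpow_mul_cosRemainder_pos hp hp')).ne'
  rw [← ENNReal.ofReal_le_ofReal_iff (by positivity), ofReal_integral_abs_rpow hp₀ hS,
    ofReal_integral_abs_rpow hp₀ hT, ← ENNReal.mul_le_mul_iff_left hC ENNReal.ofReal_ne_top,
    lintegral_abs_rpow_mul_integral_cosRemainder hS.aestronglyMeasurable.aemeasurable hp hp',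
    lintegral_abs_rpow_mul_integral_cosRemainder hT.aestronglyMeasurable.aemeasurable hp hp']
  gcongr with t
  rw [← ofReal_integral_eq_lintegral_ofReal (integrable_cosRemainder_mul (hS.mono_exponent h₂) t)
    (ae_of_all _ fun ω => cosRemainder_nonneg _),
    ← ofReal_integral_eq_lintegral_ofReal (integrable_cosRemainder_mul (hT.mono_exponent h₂) t)
    (ae_of_all _ fun ω => cosRemainder_nonneg _)]
  exact ENNReal.ofReal_le_ofReal (h t)

end CosRemainder

section CosineTransform

variable {Ω : Type*} [MeasurableSpace Ω] {P : Measure Ω} [IsFiniteMeasure P]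

lemma re_charFun_map {S : Ω → ℝ} (hS : AEMeasurable S P) (t : ℝ) :
    (charFun (P.map S) t).re = ∫ ω, Real.cos (t * S ω) ∂P := by
  have hexp : Integrable (fun ω => Complex.exp (t * S ω * Complex.I)) P :=
    Integrable.of_bound (by fun_prop) 1 (ae_of_all _ fun ω => by
      rw [← Complex.ofReal_mul, Complex.norm_exp_ofReal_mul_I])
  rw [charFun_apply_real, integral_map hS (by fun_prop), ← RCLike.re_eq_complex_re,
    ← integral_re hexp]
  refine integral_congr_ae (ae_of_all _ fun ω => ?_)
  simp only [RCLike.re_eq_complex_re, ← Complex.ofReal_mul, Complex.exp_ofReal_mul_I_re]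

lemma IsSymmetricRV.charFun_map {Y : Ω → ℝ} (hY : IsSymmetricRV Y P) (t : ℝ) :
    charFun (P.map Y) t = (∫ ω, Real.cos (t * Y ω) ∂P : ℝ) := by
  have hm : AEMeasurable Y P := hY.aemeasurable_fst
  have hconj : (starRingEnd ℂ) (charFun (P.map Y) t) = charFun (P.map Y) t := by
    rw [← charFun_neg]
    nth_rw 2 [hY.map_eq]
    rw [charFun_apply_real, charFun_apply_real, integral_map hm (by fun_prop),
      integral_map hm.fun_neg (by fun_prop)]
    simp only [Complex.ofReal_neg, neg_mul, mul_neg]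
  rw [← re_charFun_map hm, Complex.conj_eq_iff_re.1 hconj]

lemma integral_cosRemainder_mul [IsProbabilityMeasure P] {S : Ω → ℝ} (hS : MemLp S 2 P) (t : ℝ) :
    ∫ ω, cosRemainder (t * S ω) ∂P
      = ∫ ω, Real.cos (t * S ω) ∂P - 1 + t ^ 2 / 2 * ∫ ω, S ω ^ 2 ∂P := by
  have hm : AEMeasurable S P := hS.aestronglyMeasurable.aemeasurable
  have hcos : Integrable (fun ω => Real.cos (t * S ω)) P :=
    Integrable.of_bound (by fun_prop) 1 (ae_of_all _ fun ω => Real.abs_cos_le_one _)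
  have hcos' : Integrable (fun ω => Real.cos (t * S ω) - 1) P := hcos.sub (integrable_const 1)
  simp only [cosRemainder, mul_pow, mul_div_right_comm]
  rw [integral_add hcos' (hS.integrable_sq.const_mul _),
    integral_sub hcos (integrable_const 1), integral_const_mul, integral_const, probReal_univ,
    one_smul]

end CosineTransform

section ExpInequalities

lemma exp_neg_add_mul_le {A y : ℝ} (hy : 0 ≤ y) (hy₁ : y ≤ 1) :
    Real.exp (-A + A * y) ≤ Real.exp (-(A + y)) + y := by
  have hconv := convexOn_exp.2 (Set.mem_univ 0) (Set.mem_univ A) (sub_nonneg.2 hy₁) hy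
    (sub_add_cancel 1 y)
  simp only [smul_eq_mul, mul_zero, zero_add, Real.exp_zero, mul_one] at hconv
  have hinv : Real.exp (-A) * Real.exp A = 1 := by
    rw [← Real.exp_add, neg_add_cancel, Real.exp_zero]
  calc Real.exp (-A + A * y) = Real.exp (-A) * Real.exp (y * A) := by
        rw [Real.exp_add, mul_comm A]
    _ ≤ Real.exp (-A) * (1 - y + y * Real.exp A) := by gcongr
    _ = Real.exp (-A) * (1 - y) + y := by linear_combination y * hinv
    _ ≤ Real.exp (-A) * Real.exp (-y) + y := by gcongr; exact Real.one_sub_le_exp_neg y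
    _ = Real.exp (-(A + y)) + y := by rw [neg_add, Real.exp_add]

lemma one_sub_mul_exp_le {A : ℝ} (hA : 0 ≤ A) : (1 - A) * Real.exp A ≤ 1 - A ^ 2 / 2 := by
  have h₁ (x : ℝ) : HasDerivAt (fun x => (x - 1) * Real.exp x) (x * Real.exp x) x :=
    (((hasDerivAt_id x).sub_const 1).mul (Real.hasDerivAt_exp x)).congr_deriv
      (by simp only [id_eq]; ring)
  have h₂ (x : ℝ) : HasDerivAt (fun x => x * Real.exp x) ((1 + x) * Real.exp x) x :=
    ((hasDerivAt_id x).mul (Real.hasDerivAt_exp x)).congr_deriv (by simp only [id_eq]; ring)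
  have h := quadratic_le_of_le_second_deriv (c := 1) h₁ h₂ (by fun_prop) hA fun x hx =>
    one_le_mul_of_one_le_of_one_le (by linarith) (Real.one_le_exp hx)
  simp only [Real.exp_zero] at h
  linarith

lemma exp_neg_sub_sub_le {A y : ℝ} (hy : 0 ≤ y) (hyA : y ≤ A) :
    Real.exp (-(A - y)) - y ≤ Real.exp (-(A + A * y / 2)) := by
  rcases hy.eq_or_lt with rfl | hy₀
  · simp
  have hA : 0 < A := hy₀.trans_le hyA
  obtain ⟨θ, hθ₀, hθ₁, rfl⟩ : ∃ θ, 0 ≤ θ ∧ θ ≤ 1 ∧ y = θ * A :=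
    ⟨y / A, by positivity, (div_le_one hA).2 hyA, by field_simp⟩
  have hconv := convexOn_exp.2 (Set.mem_univ 0) (Set.mem_univ A) (sub_nonneg.2 hθ₁) hθ₀
    (sub_add_cancel 1 θ)
  simp only [smul_eq_mul, mul_zero, zero_add, Real.exp_zero, mul_one] at hconv
  have hinv : Real.exp (-A) * Real.exp A = 1 := by
    rw [← Real.exp_add, neg_add_cancel, Real.exp_zero]
  calc Real.exp (-(A - θ * A)) - θ * A
      = Real.exp (-A) * (Real.exp (θ * A) - θ * A * Real.exp A) := by
        rw [neg_sub', sub_neg_eq_add, Real.exp_add]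
        linear_combination (θ * A) * hinv
    _ ≤ Real.exp (-A) * (1 - θ + θ * ((1 - A) * Real.exp A)) := by gcongr; linarith
    _ ≤ Real.exp (-A) * (1 - θ + θ * (1 - A ^ 2 / 2)) := by
        gcongr
        exact one_sub_mul_exp_le hA.le
    _ = Real.exp (-A) * (1 - A * (θ * A) / 2) := by ring
    _ ≤ Real.exp (-A) * Real.exp (-(A * (θ * A) / 2)) := by
        gcongr
        exact Real.one_sub_le_exp_neg _
    _ = Real.exp (-(A + A * (θ * A) / 2)) := by rw [neg_add, Real.exp_add]

lemma exp_neg_sub_mul_sq_le {x : ℝ} (hx : 0 ≤ x) (hx' : x ≤ 2 / 3) :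
    Real.exp (-x - 3 / 2 * x ^ 2) ≤ 1 - x := by
  have hquad := Real.quadratic_le_exp_of_nonneg (by positivity : 0 ≤ x + 3 / 2 * x ^ 2)
  have hpoly : 1 ≤ (1 - x) * (1 + (x + 3 / 2 * x ^ 2) + (x + 3 / 2 * x ^ 2) ^ 2 / 2) := by
    have : 0 ≤ x ^ 2 * (1 - x / 2 - 3 / 8 * x ^ 2 - 9 / 8 * x ^ 3) :=
      mul_nonneg (sq_nonneg x) (by nlinarith [pow_le_pow_left₀ hx hx' 2, pow_le_pow_left₀ hx hx' 3])
    linarith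
  rw [show -x - 3 / 2 * x ^ 2 = -(x + 3 / 2 * x ^ 2) by ring, Real.exp_neg,
    inv_le_iff_one_le_mul₀ (Real.exp_pos _)]
  exact hpoly.trans (by gcongr; linarith)

end ExpInequalities

namespace IsSymmetricNBU

variable {Ω : Type*} [MeasurableSpace Ω] {P : Measure Ω} [IsProbabilityMeasure P] {Y : Ω → ℝ}

lemma one_sub_le_integral_cos (hY : IsSymmetricNBU Y P) (t : ℝ) :
    1 - t ^ 2 / 2 * Var[Y; P] ≤ ∫ ω, Real.cos (t * Y ω) ∂P := by
  have h : 0 ≤ ∫ ω, cosRemainder (t * Y ω) ∂P := integral_nonneg fun ω => cosRemainder_nonneg _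
  rw [integral_cosRemainder_mul hY.memLp_two, ← hY.symm.variance_eq] at h
  linarith

lemma abs_integral_cos_le (hY : IsSymmetricNBU Y P) (t : ℝ) :
    |∫ ω, Real.cos (t * Y ω) ∂P| ≤ 1 - t ^ 2 / 2 * Var[Y; P] + (t ^ 2 / 2 * Var[Y; P]) ^ 2 := by
  have hY₄ : Integrable (fun ω => Y ω ^ 4) P := by
    simpa [(by decide : Even 4).pow_abs] using
      integrable_abs_rpow_of_memLp four_pos (hY.memLp 4)
  have hrem : ∫ ω, cosRemainder (t * Y ω) ∂P ≤ (t ^ 2 / 2 * Var[Y; P]) ^ 2 :=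
    calc ∫ ω, cosRemainder (t * Y ω) ∂P ≤ ∫ ω, t ^ 4 / 24 * Y ω ^ 4 ∂P :=
          integral_mono (integrable_cosRemainder_mul hY.memLp_two t) (hY₄.const_mul _) fun ω =>
            (cosRemainder_le_pow_four_div _).trans_eq (by ring)
      _ = t ^ 4 / 24 * ∫ ω, Y ω ^ 4 ∂P := integral_const_mul _ _
      _ ≤ t ^ 4 / 24 * (6 * Var[Y; P] ^ 2) := by gcongr; exact hY.integral_pow_four_le
      _ = (t ^ 2 / 2 * Var[Y; P]) ^ 2 := by ring
  rw [integral_cosRemainder_mul hY.memLp_two, ← hY.symm.variance_eq] at hrem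
  have hlow := hY.one_sub_le_integral_cos t
  rw [abs_le]
  constructor <;> nlinarith [sq_nonneg (t ^ 2 / 2 * Var[Y; P] - 1)]

end IsSymmetricNBU

section Sums

variable {Ω : Type*} [MeasurableSpace Ω] {P : Measure Ω} [IsProbabilityMeasure P] {ι : Type*}
  {Y : ι → Ω → ℝ}

lemma integral_cos_mul_sum (hY : ∀ i, IsSymmetricRV (Y i) P) (hind : iIndepFun Y P)
    (s : Finset ι) (t : ℝ) :
    ∫ ω, Real.cos (t * ∑ i ∈ s, Y i ω) ∂P = ∏ i ∈ s, ∫ ω, Real.cos (t * Y i ω) ∂P := by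
  have hm (i : ι) : AEMeasurable (Y i) P := (hY i).aemeasurable_fst
  rw [← re_charFun_map (by fun_prop), (hind.restrict s).charFun_map_fun_finsetSum_eq_prod
    fun i _ => hm i, Finset.prod_apply, Finset.prod_congr rfl fun i _ => (hY i).charFun_map t,
    ← Complex.ofReal_prod, Complex.ofReal_re]

lemma abs_integral_cos_le_one (S : Ω → ℝ) : |∫ ω, Real.cos (S ω) ∂P| ≤ 1 := by
  simpa using norm_integral_le_of_norm_le_const (f := fun ω => Real.cos (S ω)) (C := 1)
    (ae_of_all P fun ω => Real.abs_cos_le_one (S ω))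

lemma sum_sq_le_sum_mul {s : Finset ι} {x : ι → ℝ} {m : ℝ} (h₀ : ∀ i ∈ s, 0 ≤ x i)
    (hm : ∀ i ∈ s, x i ≤ m) : ∑ i ∈ s, x i ^ 2 ≤ (∑ i ∈ s, x i) * m := by
  rw [Finset.sum_mul]
  exact Finset.sum_le_sum fun i hi => by
    rw [sq]
    exact mul_le_mul_of_nonneg_left (hm i hi) (h₀ i hi)

variable {s : Finset ι} {M : ℝ}

lemma integral_cos_mul_sum_le (hY : ∀ i, IsSymmetricNBU (Y i) P) (hind : iIndepFun Y P)
    (hM : 0 ≤ M) (hv : ∀ i ∈ s, Var[Y i; P] ≤ M) (t : ℝ) :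
    ∫ ω, Real.cos (t * ∑ i ∈ s, Y i ω) ∂P
      ≤ Real.exp (-(t ^ 2 / 2 * (∑ i ∈ s, Var[Y i; P] + M))) + t ^ 2 / 2 * M := by
  rcases le_total 1 (t ^ 2 / 2 * M) with h | h
  · exact (le_of_abs_le (abs_integral_cos_le_one _)).trans
      (h.trans (le_add_of_nonneg_left (Real.exp_pos _).le))
  set x : ι → ℝ := fun i => t ^ 2 / 2 * Var[Y i; P]
  have hx₀ : ∀ i ∈ s, 0 ≤ x i := fun i _ => mul_nonneg (by positivity) (variance_nonneg _ _)
  calc ∫ ω, Real.cos (t * ∑ i ∈ s, Y i ω) ∂P ≤ ∏ i ∈ s, |∫ ω, Real.cos (t * Y i ω) ∂P| := by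
        rw [integral_cos_mul_sum (fun i => (hY i).symm) hind, ← Finset.abs_prod]
        exact le_abs_self _
    _ ≤ ∏ i ∈ s, Real.exp (-x i + x i ^ 2) :=
        Finset.prod_le_prod (fun i _ => abs_nonneg _) fun i _ =>
          ((hY i).abs_integral_cos_le t).trans
            ((Real.add_one_le_exp (-x i + x i ^ 2)).trans' (le_of_eq (by simp only [x]; ring)))
    _ = Real.exp (-(∑ i ∈ s, x i) + ∑ i ∈ s, x i ^ 2) := by
        rw [← Real.exp_sum, Finset.sum_add_distrib, Finset.sum_neg_distrib]
    _ ≤ Real.exp (-(∑ i ∈ s, x i) + (∑ i ∈ s, x i) * (t ^ 2 / 2 * M)) := by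
        gcongr
        exact sum_sq_le_sum_mul hx₀ fun i hi =>
          mul_le_mul_of_nonneg_left (hv i hi) (by positivity)
    _ ≤ Real.exp (-(∑ i ∈ s, x i + t ^ 2 / 2 * M)) + t ^ 2 / 2 * M :=
        exp_neg_add_mul_le (by positivity) h
    _ = _ := by rw [← Finset.mul_sum, ← mul_add]

lemma le_integral_cos_mul_sum (hY : ∀ i, IsSymmetricNBU (Y i) P) (hind : iIndepFun Y P)
    (hM : 0 ≤ M) (hv : ∀ i ∈ s, Var[Y i; P] ≤ M) (hs : 3 * M ≤ ∑ i ∈ s, Var[Y i; P]) (t : ℝ) :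
    Real.exp (-(t ^ 2 / 2 * (∑ i ∈ s, Var[Y i; P] - 3 * M))) - t ^ 2 / 2 * (3 * M)
      ≤ ∫ ω, Real.cos (t * ∑ i ∈ s, Y i ω) ∂P := by
  rcases le_total (2 / 3) (t ^ 2 / 2 * M) with h | h
  · have hexp : Real.exp (-(t ^ 2 / 2 * (∑ i ∈ s, Var[Y i; P] - 3 * M))) ≤ 1 :=
      Real.exp_le_one_iff.2 (neg_nonpos.2 (mul_nonneg (by positivity) (sub_nonneg.2 hs)))
    linarith [neg_le_of_abs_le (abs_integral_cos_le_one (P := P) fun ω => t * ∑ i ∈ s, Y i ω)]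
  set x : ι → ℝ := fun i => t ^ 2 / 2 * Var[Y i; P]
  have hx₀ : ∀ i ∈ s, 0 ≤ x i := fun i _ => mul_nonneg (by positivity) (variance_nonneg _ _)
  have hxM : ∀ i ∈ s, x i ≤ t ^ 2 / 2 * M := fun i hi =>
    mul_le_mul_of_nonneg_left (hv i hi) (by positivity)
  have hsum : t ^ 2 / 2 * ∑ i ∈ s, Var[Y i; P] = ∑ i ∈ s, x i := Finset.mul_sum _ _ _
  calc Real.exp (-(t ^ 2 / 2 * (∑ i ∈ s, Var[Y i; P] - 3 * M))) - t ^ 2 / 2 * (3 * M)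
      = Real.exp (-(∑ i ∈ s, x i - t ^ 2 / 2 * (3 * M))) - t ^ 2 / 2 * (3 * M) := by
        rw [mul_sub, hsum]
    _ ≤ Real.exp (-(∑ i ∈ s, x i + (∑ i ∈ s, x i) * (t ^ 2 / 2 * (3 * M)) / 2)) :=
        exp_neg_sub_sub_le (by positivity) (by rw [← hsum]; gcongr)
    _ ≤ Real.exp (-(∑ i ∈ s, x i) - 3 / 2 * ∑ i ∈ s, x i ^ 2) := by
        gcongr
        linarith [sum_sq_le_sum_mul hx₀ hxM]
    _ = ∏ i ∈ s, Real.exp (-x i - 3 / 2 * x i ^ 2) := by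
        rw [← Real.exp_sum, Finset.sum_sub_distrib, Finset.sum_neg_distrib, Finset.mul_sum]
    _ ≤ ∏ i ∈ s, ∫ ω, Real.cos (t * Y i ω) ∂P :=
        Finset.prod_le_prod (fun i _ => (Real.exp_pos _).le) fun i hi =>
          (exp_neg_sub_mul_sq_le (hx₀ i hi) ((hxM i hi).trans h)).trans
            ((hY i).one_sub_le_integral_cos t)
    _ = ∫ ω, Real.cos (t * ∑ i ∈ s, Y i ω) ∂P :=
        (integral_cos_mul_sum (fun i => (hY i).symm) hind s t).symm

end Sums

section LpNorm

variable {Ω : Type*} [MeasurableSpace Ω] {P : Measure Ω} {S : Ω → ℝ} {p : ℝ}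

lemma lpNorm_ofReal_rpow (hp : 0 < p) (hS : MemLp S (ENNReal.ofReal p) P) :
    lpNorm S (ENNReal.ofReal p) P ^ p = ∫ ω, |S ω| ^ p ∂P := by
  rw [lpNorm_eq_integral_norm_rpow_toReal (ENNReal.ofReal_pos.2 hp).ne' ENNReal.ofReal_ne_top
    hS.aestronglyMeasurable, ENNReal.toReal_ofReal hp.le, Real.rpow_inv_rpow _ hp.ne']
  · simp only [Real.norm_eq_abs]
  · exact integral_nonneg fun ω => by positivity

end LpNorm

section Gaussian

variable {p w : ℝ}

lemma memLp_mul_gaussianReal (c p : ℝ) :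
    MemLp (fun x => c * x) (ENNReal.ofReal p) (gaussianReal 0 1) :=
  (memLp_id_gaussianReal' _ ENNReal.ofReal_ne_top).const_mul c

lemma gaussianNorm_nonneg (p : ℝ) : 0 ≤ gaussianNorm p :=
  lpNorm_nonneg

lemma gaussianNorm_rpow (hp : 0 < p) :
    gaussianNorm p ^ p = ∫ x, |x| ^ p ∂(gaussianReal 0 1) :=
  lpNorm_ofReal_rpow hp (memLp_id_gaussianReal' _ ENNReal.ofReal_ne_top)

lemma gaussianNorm_rpow_eq_Gamma (hp : 0 < p) : gaussianNorm p ^ p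
    = (√(2 * Real.pi))⁻¹ * (1 / 2) ^ (-(p + 1) / 2) * Real.Gamma ((p + 1) / 2) := by
  have hdens (x : ℝ) : gaussianPDFReal 0 1 x • |x| ^ p
      = (√(2 * Real.pi))⁻¹ * (|x| ^ p * Real.exp (-(1 / 2) * |x| ^ (2 : ℝ))) := by
    simp only [gaussianPDFReal, Real.rpow_two, sq_abs, smul_eq_mul, sub_zero, NNReal.coe_one,
      mul_one]
    ring_nf
  rw [gaussianNorm_rpow hp, integral_gaussianReal_eq_integral_smul one_ne_zero,
    integral_congr_ae (ae_of_all _ hdens), integral_const_mul,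
    integral_comp_abs (f := fun x => x ^ p * Real.exp (-(1 / 2) * x ^ (2 : ℝ))),
    integral_rpow_mul_exp_neg_mul_rpow (by norm_num) (by linarith) (by norm_num)]
  ring

lemma gaussianNorm_pos (hp : 0 < p) : 0 < gaussianNorm p := by
  refine (gaussianNorm_nonneg p).lt_of_ne fun h => ?_
  have := Real.Gamma_pos_of_pos (by linarith : 0 < (p + 1) / 2)
  have hrpow := gaussianNorm_rpow_eq_Gamma hp
  rw [← h, Real.zero_rpow hp.ne'] at hrpow
  exact absurd hrpow (by positivity)

lemma gaussianNorm_rpow_eq_mul (hp : 2 < p) :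
    gaussianNorm p ^ p = (p - 1) * gaussianNorm (p - 2) ^ (p - 2) := by
  rw [gaussianNorm_rpow_eq_Gamma (by linarith), gaussianNorm_rpow_eq_Gamma (by linarith),
    show (p + 1) / 2 = (p - 2 + 1) / 2 + 1 by ring, Real.Gamma_add_one (by linarith),
    show -(p + 1) / 2 = -(p - 2 + 1) / 2 + (-1) by ring, Real.rpow_add (by norm_num),
    Real.rpow_neg_one]
  ring

lemma gaussianNorm_two : gaussianNorm 2 = 1 := by
  have hvar := variance_eq_integral (μ := gaussianReal 0 1) (X := fun x => x) (by fun_prop)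
  have hsq : gaussianNorm 2 ^ 2 = 1 := by
    simpa [← Real.rpow_two (gaussianNorm 2), gaussianNorm_rpow two_pos] using hvar.symm
  exact (pow_eq_one_iff_of_nonneg (gaussianNorm_nonneg 2) two_ne_zero).1 hsq

lemma gaussianNorm_mono {q : ℝ} (hpq : p ≤ q) : gaussianNorm p ≤ gaussianNorm q := by
  have hmem (r : ℝ) : MemLp (fun x : ℝ => x) (ENNReal.ofReal r) (gaussianReal 0 1) :=
    memLp_id_gaussianReal' _ ENNReal.ofReal_ne_top
  rw [gaussianNorm, gaussianNorm, ← ENNReal.ofReal_le_ofReal_iff lpNorm_nonneg,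
    ofReal_lpNorm (hmem p), ofReal_lpNorm (hmem q)]
  exact eLpNorm_le_eLpNorm_of_exponent_le (ENNReal.ofReal_le_ofReal hpq)
    (hmem p).aestronglyMeasurable

lemma gaussianNorm_sq_le (hp : 2 ≤ p) : gaussianNorm p ^ 2 ≤ p - 1 := by
  rcases hp.eq_or_lt with rfl | hp
  · norm_num [gaussianNorm_two]
  have hγ := gaussianNorm_pos (by linarith : 0 < p)
  have hγ' := gaussianNorm_pos (by linarith : 0 < p - 2)
  refine le_of_mul_le_mul_right ?_ (Real.rpow_pos_of_pos hγ (p - 2))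
  calc gaussianNorm p ^ 2 * gaussianNorm p ^ (p - 2)
      = gaussianNorm p ^ p := by
        rw [← Real.rpow_two, ← Real.rpow_add hγ, add_sub_cancel]
    _ = (p - 1) * gaussianNorm (p - 2) ^ (p - 2) := gaussianNorm_rpow_eq_mul hp
    _ ≤ (p - 1) * gaussianNorm p ^ (p - 2) :=
        mul_le_mul_of_nonneg_left (Real.rpow_le_rpow hγ'.le (gaussianNorm_mono (by linarith))
          (by linarith)) (by linarith)

lemma gaussianNorm_mul_sqrt_rpow (p : ℝ) (hw : 0 ≤ w) :
    (gaussianNorm p * √w) ^ p = gaussianNorm p ^ p * w ^ (p / 2) := by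
  rw [Real.mul_rpow (gaussianNorm_nonneg p) (Real.sqrt_nonneg w), Real.sqrt_eq_rpow,
    ← Real.rpow_mul hw, one_div_mul_eq_div]

lemma integral_abs_sqrt_mul_rpow_gaussianReal (hp : 0 < p) (hw : 0 ≤ w) :
    ∫ x, |√w * x| ^ p ∂(gaussianReal 0 1) = gaussianNorm p ^ p * w ^ (p / 2) := by
  simp only [abs_mul, abs_of_nonneg (Real.sqrt_nonneg w),
    Real.mul_rpow (Real.sqrt_nonneg w) (abs_nonneg _)]
  rw [integral_const_mul, ← gaussianNorm_rpow hp, ← gaussianNorm_mul_sqrt_rpow p hw,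
    Real.mul_rpow (gaussianNorm_nonneg p) (Real.sqrt_nonneg w), mul_comm]

lemma integral_cos_mul_gaussianReal (t : ℝ) :
    ∫ x, Real.cos (t * x) ∂(gaussianReal 0 1) = Real.exp (-(t ^ 2 / 2)) := by
  rw [← re_charFun_map aemeasurable_id', Measure.map_id', charFun_gaussianReal]
  rw [show (t : ℂ) * ((0 : ℝ) : ℂ) * Complex.I - ((1 : NNReal) : ℂ) * (t : ℂ) ^ 2 / 2
    = ((-(t ^ 2 / 2) : ℝ) : ℂ) by push_cast; ring, Complex.exp_ofReal_re]

lemma integral_cosRemainder_sqrt_mul_gaussianReal (hw : 0 ≤ w) (t : ℝ) :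
    ∫ x, cosRemainder (t * (√w * x)) ∂(gaussianReal 0 1)
      = Real.exp (-(t ^ 2 / 2 * w)) - 1 + t ^ 2 / 2 * w := by
  have hsq := integral_abs_sqrt_mul_rpow_gaussianReal two_pos hw
  simp only [Real.rpow_two, sq_abs, gaussianNorm_two, one_pow, div_self (two_ne_zero' ℝ),
    Real.rpow_one, one_mul] at hsq
  rw [integral_cosRemainder_mul (by simpa using memLp_mul_gaussianReal √w 2), hsq]
  simp only [← mul_assoc, integral_cos_mul_gaussianReal, mul_pow, Real.sq_sqrt hw]
  norm_num
  ring_nf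

end Gaussian

section StepInduction

@[elab_as_elim]
lemma le_induction_add {a d : ℝ} (hd : 0 < d) {motive : ∀ p, a ≤ p → Prop}
    (base : ∀ p (hp : a ≤ p), p < a + d → motive p hp)
    (step : ∀ p (hp : a + d ≤ p), motive (p - d) (le_sub_iff_add_le.2 hp) →
      motive p (le_of_add_le_of_nonneg_left hp hd.le)) (p : ℝ) (hp : a ≤ p) : motive p hp := by
  obtain ⟨n, hn⟩ := exists_nat_gt ((p - a) / d)
  replace hn : p < a + n * d := by linarith [(div_lt_iff₀ hd).1 hn]
  induction n generalizing p with
  | zero => exact absurd hn (by simpa using hp)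
  | succ n ih =>
    rcases lt_or_ge p (a + d) with h | h
    · exact base p hp h
    · push_cast at hn
      exact step p h (ih _ _ (by linarith))

lemma rpow_add_mul_sub_le_rpow {a b r : ℝ} (ha : 0 ≤ a) (hb : 0 ≤ b) (hr : 1 < r) :
    b ^ r + r * b ^ (r - 1) * (a - b) ≤ a ^ r := by
  rcases hb.eq_or_lt with rfl | hb
  · rw [Real.zero_rpow (by linarith), Real.zero_rpow (by linarith)]
    simpa using Real.rpow_nonneg ha r
  have hbernoulli := one_add_mul_self_le_rpow_one_add
    (by linarith [div_nonneg ha hb.le] : -1 ≤ a / b - 1) hr.le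
  rw [add_sub_cancel, Real.div_rpow ha hb.le, le_div_iff₀ (by positivity)] at hbernoulli
  refine le_trans (le_of_eq ?_) hbernoulli
  rw [Real.rpow_sub_one hb.ne']
  field_simp

end StepInduction

section Moments

variable {Ω : Type*} [MeasurableSpace Ω] {P : Measure Ω} {ι : Type*} {Y : ι → Ω → ℝ}

lemma indepFun_sum_of_notMem (hY : ∀ i, IsSymmetricNBU (Y i) P) (hind : iIndepFun Y P)
    {s : Finset ι} {i : ι} (hi : i ∉ s) : IndepFun (fun ω => ∑ j ∈ s, Y j ω) (Y i) P := by
  simpa only [Finset.sum_fn] using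
    hind.indepFun_finsetSum_of_notMem₀ (fun j => (hY j).aemeasurable) hi

variable [IsProbabilityMeasure P] {p M c : ℝ}

lemma memLp_sum (hY : ∀ i, IsSymmetricNBU (Y i) P) (s : Finset ι) (p : ℝ) :
    MemLp (fun ω => ∑ i ∈ s, Y i ω) (ENNReal.ofReal p) P :=
  memLp_finsetSum _ fun i _ => (hY i).memLp p

lemma integral_sum_sq (hY : ∀ i, IsSymmetricNBU (Y i) P) (hind : iIndepFun Y P) (s : Finset ι) :
    ∫ ω, (∑ i ∈ s, Y i ω) ^ 2 ∂P = ∑ i ∈ s, Var[Y i; P] := by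
  have hmean : ∫ ω, (∑ i ∈ s, Y i) ω ∂P = 0 := by
    simp only [Finset.sum_apply]
    rw [integral_finsetSum _ fun i _ => (hY i).memLp_two.integrable one_le_two]
    exact Finset.sum_eq_zero fun i _ => (hY i).symm.integral_eq_zero
  rw [← IndepFun.variance_sum (fun i _ => (hY i).memLp_two) fun i _ j _ hij => hind.indepFun hij,
    variance_of_integral_eq_zero (Finset.aemeasurable_sum _ fun i _ => (hY i).aemeasurable) hmean]
  simp only [Finset.sum_apply]

lemma integral_abs_sum_rpow_le_of_lt_four (hY : ∀ i, IsSymmetricNBU (Y i) P)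
    (hind : iIndepFun Y P) (hM : 0 ≤ M) (hv : ∀ i, Var[Y i; P] ≤ M) (hp : 2 ≤ p) (hp' : p < 4)
    (s : Finset ι) :
    ∫ ω, |∑ i ∈ s, Y i ω| ^ p ∂P
      ≤ gaussianNorm p ^ p * (∑ i ∈ s, Var[Y i; P] + M) ^ (p / 2) := by
  have hσ : 0 ≤ ∑ i ∈ s, Var[Y i; P] := Finset.sum_nonneg fun i _ => variance_nonneg _ _
  rcases hp.eq_or_lt with rfl | hp
  · simpa [integral_sum_sq hY hind, gaussianNorm_two] using hM
  rw [← integral_abs_sqrt_mul_rpow_gaussianReal (by linarith) (by positivity)]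
  refine integral_abs_rpow_le_of_integral_cosRemainder_le hp hp' (memLp_sum hY s p)
    (memLp_mul_gaussianReal _ p) fun t => ?_
  rw [integral_cosRemainder_mul (by simpa using memLp_sum hY s 2), integral_sum_sq hY hind,
    integral_cosRemainder_sqrt_mul_gaussianReal (by positivity)]
  linarith [integral_cos_mul_sum_le hY hind hM (fun i (_ : i ∈ s) => hv i) t]

lemma le_integral_abs_sum_rpow_of_lt_four (hY : ∀ i, IsSymmetricNBU (Y i) P)
    (hind : iIndepFun Y P) (hM : 0 ≤ M) (hv : ∀ i, Var[Y i; P] ≤ M) (hp : 2 ≤ p) (hp' : p < 4)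
    (s : Finset ι) :
    gaussianNorm p ^ p * max 0 (∑ i ∈ s, Var[Y i; P] - 3 * M) ^ (p / 2)
      ≤ ∫ ω, |∑ i ∈ s, Y i ω| ^ p ∂P := by
  rcases le_total (∑ i ∈ s, Var[Y i; P]) (3 * M) with hσ | hσ
  · rw [max_eq_left (by linarith), Real.zero_rpow (by linarith), mul_zero]
    exact integral_nonneg fun ω => by positivity
  have hσ' : 0 ≤ ∑ i ∈ s, Var[Y i; P] - 3 * M := sub_nonneg.2 hσ
  rw [max_eq_right hσ']
  rcases hp.eq_or_lt with rfl | hp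
  · simpa [integral_sum_sq hY hind, gaussianNorm_two] using hM
  rw [← integral_abs_sqrt_mul_rpow_gaussianReal (by linarith) hσ']
  refine integral_abs_rpow_le_of_integral_cosRemainder_le hp hp' (memLp_mul_gaussianReal _ p)
    (memLp_sum hY s p) fun t => ?_
  rw [integral_cosRemainder_sqrt_mul_gaussianReal hσ',
    integral_cosRemainder_mul (by simpa using memLp_sum hY s 2), integral_sum_sq hY hind]
  linarith [le_integral_cos_mul_sum hY hind hM (fun i (_ : i ∈ s) => hv i) hσ t]

lemma integral_abs_sum_rpow_le_of_sub_two (hY : ∀ i, IsSymmetricNBU (Y i) P)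
    (hind : iIndepFun Y P) (hM : 0 ≤ M) (hv : ∀ i, Var[Y i; P] ≤ M) (hp : 4 ≤ p) (hc : 0 ≤ c)
    (h : ∀ s : Finset ι, ∫ ω, |∑ i ∈ s, Y i ω| ^ (p - 2) ∂P
      ≤ gaussianNorm (p - 2) ^ (p - 2) * (∑ i ∈ s, Var[Y i; P] + c) ^ (p / 2 - 1))
    (s : Finset ι) :
    ∫ ω, |∑ i ∈ s, Y i ω| ^ p ∂P
      ≤ gaussianNorm p ^ p * (∑ i ∈ s, Var[Y i; P] + (c + M)) ^ (p / 2) := by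
  classical
  have hγ := gaussianNorm_nonneg p
  have hγ' := gaussianNorm_nonneg (p - 2)
  induction s using Finset.induction_on with
  | empty =>
    simp only [Finset.sum_empty, abs_zero, Real.zero_rpow (by linarith : p ≠ 0), integral_zero]
    positivity
  | insert i s hi ih =>
    have hvi := variance_nonneg (Y i) P
    have hσ : 0 ≤ ∑ i ∈ s, Var[Y i; P] := Finset.sum_nonneg fun i _ => variance_nonneg _ _
    have h' := h (insert i s)
    simp only [Finset.sum_insert hi, add_comm (Y i _), add_comm (Var[Y i; P])] at h' ⊢
    have hle : ∑ j ∈ s, Var[Y j; P] + Var[Y i; P] + c ≤ ∑ j ∈ s, Var[Y j; P] + (c + M) := by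
      linarith [hv i]
    set b := ∑ j ∈ s, Var[Y j; P] + (c + M)
    have hb : 0 ≤ b := by positivity
    have hmono : (∑ j ∈ s, Var[Y j; P] + Var[Y i; P] + c) ^ (p / 2 - 1) ≤ b ^ (p / 2 - 1) :=
      Real.rpow_le_rpow (add_nonneg (add_nonneg hσ hvi) hc) hle (by linarith)
    have htangent := rpow_add_mul_sub_le_rpow (add_nonneg hb hvi) hb (by linarith : 1 < p / 2)
    calc ∫ ω, |∑ j ∈ s, Y j ω + Y i ω| ^ p ∂P
        ≤ ∫ ω, |∑ j ∈ s, Y j ω| ^ p ∂P + p * (p - 1) / 2 * Var[Y i; P]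
            * ∫ ω, |∑ j ∈ s, Y j ω + Y i ω| ^ (p - 2) ∂P :=
          (hY i).integral_abs_add_rpow_le (memLp_sum hY s p) (indepFun_sum_of_notMem hY hind hi) hp
      _ ≤ gaussianNorm p ^ p * b ^ (p / 2) + p * (p - 1) / 2 * Var[Y i; P]
            * (gaussianNorm (p - 2) ^ (p - 2) * b ^ (p / 2 - 1)) := by
          have : 0 ≤ p - 1 := by linarith
          gcongr
          exact h'.trans (by gcongr)
      _ = gaussianNorm p ^ p * (b ^ (p / 2) + p / 2 * b ^ (p / 2 - 1) * (b + Var[Y i; P] - b)) := by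
          rw [gaussianNorm_rpow_eq_mul (by linarith)]
          ring
      _ ≤ gaussianNorm p ^ p * (b + Var[Y i; P]) ^ (p / 2) := by gcongr
      _ = _ := by rw [add_right_comm]

lemma le_integral_abs_sum_rpow_of_sub_two (hY : ∀ i, IsSymmetricNBU (Y i) P)
    (hind : iIndepFun Y P) (hM : 0 ≤ M) (hv : ∀ i, Var[Y i; P] ≤ M) (hp : 4 ≤ p) (hc : 0 ≤ c)
    (h : ∀ s : Finset ι,
      gaussianNorm (p - 2) ^ (p - 2) * max 0 (∑ i ∈ s, Var[Y i; P] - c) ^ (p / 2 - 1)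
        ≤ ∫ ω, |∑ i ∈ s, Y i ω| ^ (p - 2) ∂P) (s : Finset ι) :
    gaussianNorm p ^ p * max 0 (∑ i ∈ s, Var[Y i; P] - (c + M)) ^ (p / 2)
      ≤ ∫ ω, |∑ i ∈ s, Y i ω| ^ p ∂P := by
  classical
  have hγ := gaussianNorm_nonneg p
  have hγ' := gaussianNorm_nonneg (p - 2)
  induction s using Finset.induction_on with
  | empty =>
    rw [Finset.sum_empty, max_eq_left (by linarith), Real.zero_rpow (by linarith), mul_zero]
    exact integral_nonneg fun ω => by positivity
  | insert i s hi ih =>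
    have hvi := variance_nonneg (Y i) P
    simp only [Finset.sum_insert hi, add_comm (Y i _), add_comm (Var[Y i; P])]
    set b := max 0 (∑ j ∈ s, Var[Y j; P] - (c + M))
    set b' := max 0 (∑ j ∈ s, Var[Y j; P] + Var[Y i; P] - (c + M))
    have hb : 0 ≤ b := le_max_left _ _
    have hb' : 0 ≤ b' := le_max_left _ _
    have hbb' : b' - b ≤ Var[Y i; P] := sub_le_iff_le_add.2 <| max_le (by positivity) (by
      linarith [le_max_right 0 (∑ j ∈ s, Var[Y j; P] - (c + M))])
    have hmono : b' ^ (p / 2 - 1) ≤ max 0 (∑ j ∈ s, Var[Y j; P] - c) ^ (p / 2 - 1) :=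
      Real.rpow_le_rpow hb' (max_le_max_left _ (by linarith [hv i])) (by linarith)
    have htangent := rpow_add_mul_sub_le_rpow hb hb' (by linarith : 1 < p / 2)
    have hp₁ : 0 ≤ p - 1 := by linarith
    calc gaussianNorm p ^ p * b' ^ (p / 2)
        ≤ gaussianNorm p ^ p * (b ^ (p / 2) + p / 2 * b' ^ (p / 2 - 1) * (b' - b)) := by
          gcongr
          linarith
      _ ≤ gaussianNorm p ^ p * (b ^ (p / 2) + p / 2 * b' ^ (p / 2 - 1) * Var[Y i; P]) := by gcongr
      _ = gaussianNorm p ^ p * b ^ (p / 2) + p * (p - 1) / 2 * Var[Y i; P]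
            * (gaussianNorm (p - 2) ^ (p - 2) * b' ^ (p / 2 - 1)) := by
          rw [gaussianNorm_rpow_eq_mul (by linarith)]
          ring
      _ ≤ ∫ ω, |∑ j ∈ s, Y j ω| ^ p ∂P + p * (p - 1) / 2 * Var[Y i; P]
            * ∫ ω, |∑ j ∈ s, Y j ω| ^ (p - 2) ∂P := by
          gcongr
          exact le_trans (by gcongr) (h s)
      _ ≤ ∫ ω, |∑ j ∈ s, Y j ω + Y i ω| ^ p ∂P :=
          (hY i).le_integral_abs_add_rpow (memLp_sum hY s p) (indepFun_sum_of_notMem hY hind hi)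
            (by linarith)

lemma integral_abs_sum_rpow_le (hY : ∀ i, IsSymmetricNBU (Y i) P) (hind : iIndepFun Y P)
    (hM : 0 ≤ M) (hv : ∀ i, Var[Y i; P] ≤ M) (hp : 2 ≤ p) (s : Finset ι) :
    ∫ ω, |∑ i ∈ s, Y i ω| ^ p ∂P
      ≤ gaussianNorm p ^ p * (∑ i ∈ s, Var[Y i; P] + p / 2 * M) ^ (p / 2) := by
  induction p, hp using le_induction_add (hd := two_pos (α := ℝ)) generalizing s with
  | base p hp hp' =>
    have hσ : 0 ≤ ∑ i ∈ s, Var[Y i; P] := Finset.sum_nonneg fun i _ => variance_nonneg _ _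
    have hγ := gaussianNorm_nonneg p
    refine (integral_abs_sum_rpow_le_of_lt_four hY hind hM hv hp (by linarith) s).trans ?_
    gcongr
    exact le_mul_of_one_le_left hM (by linarith)
  | step p hp h =>
    have hstep := integral_abs_sum_rpow_le_of_sub_two hY hind hM hv (by linarith)
      (mul_nonneg (by linarith) hM : 0 ≤ (p / 2 - 1) * M)
      (by simpa only [sub_div, div_self (two_ne_zero' ℝ)] using h)
    simpa only [← add_one_mul, sub_add_cancel] using hstep s

lemma le_integral_abs_sum_rpow (hY : ∀ i, IsSymmetricNBU (Y i) P) (hind : iIndepFun Y P)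
    (hM : 0 ≤ M) (hv : ∀ i, Var[Y i; P] ≤ M) (hp : 2 ≤ p) (s : Finset ι) :
    gaussianNorm p ^ p * max 0 (∑ i ∈ s, Var[Y i; P] - (p / 2 + 2) * M) ^ (p / 2)
      ≤ ∫ ω, |∑ i ∈ s, Y i ω| ^ p ∂P := by
  induction p, hp using le_induction_add (hd := two_pos (α := ℝ)) generalizing s with
  | base p hp hp' =>
    have hγ := gaussianNorm_nonneg p
    refine le_trans ?_ (le_integral_abs_sum_rpow_of_lt_four hY hind hM hv hp (by linarith) s)
    gcongr
    linarith
  | step p hp h =>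
    have hstep := le_integral_abs_sum_rpow_of_sub_two hY hind hM hv (by linarith)
      (mul_nonneg (by linarith) hM : 0 ≤ (p / 2 - 1 + 2) * M)
      (by simpa only [sub_div, div_self (two_ne_zero' ℝ)] using h)
    have hc : (p / 2 - 1 + 2) * M + M = (p / 2 + 2) * M := by ring
    simpa only [hc] using hstep s

end Moments

section Norms

lemma sqrt_add_le_sqrt_add_sqrt {x y : ℝ} (hx : 0 ≤ x) (hy : 0 ≤ y) : √(x + y) ≤ √x + √y := by
  rw [Real.sqrt_le_left (by positivity), add_sq, Real.sq_sqrt hx, Real.sq_sqrt hy]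
  linarith [mul_nonneg (Real.sqrt_nonneg x) (Real.sqrt_nonneg y)]

lemma gaussianNorm_mul_sqrt_le {p : ℝ} (hp : 2 ≤ p) : gaussianNorm p * √(p / 2 + 2) ≤ p := by
  refine le_of_abs_le (abs_le_of_sq_le_sq ?_ (by linarith))
  calc (gaussianNorm p * √(p / 2 + 2)) ^ 2 = gaussianNorm p ^ 2 * (p / 2 + 2) := by
        rw [mul_pow, Real.sq_sqrt (by linarith)]
    _ ≤ (p - 1) * (p / 2 + 2) :=
        mul_le_mul_of_nonneg_right (gaussianNorm_sq_le hp) (by linarith)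
    _ ≤ p ^ 2 := by nlinarith [sq_nonneg (p - 2)]

variable {Ω : Type*} [MeasurableSpace Ω] {P : Measure Ω} [IsProbabilityMeasure P] {ι : Type*}
  {Y : ι → Ω → ℝ} {p M : ℝ}

lemma lpNorm_sum_le (hY : ∀ i, IsSymmetricNBU (Y i) P) (hind : iIndepFun Y P)
    (hM : 0 ≤ M) (hv : ∀ i, Var[Y i; P] ≤ M) (hp : 2 ≤ p) (s : Finset ι) :
    lpNorm (fun ω => ∑ i ∈ s, Y i ω) (ENNReal.ofReal p) P
      ≤ gaussianNorm p * √(∑ i ∈ s, Var[Y i; P] + p / 2 * M) := by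
  have hp₀ : 0 < p := by linarith
  have hσ : 0 ≤ ∑ i ∈ s, Var[Y i; P] := Finset.sum_nonneg fun i _ => variance_nonneg _ _
  have hγ := gaussianNorm_nonneg p
  rw [← Real.rpow_le_rpow_iff lpNorm_nonneg (by positivity) hp₀,
    lpNorm_ofReal_rpow hp₀ (memLp_sum hY s p), gaussianNorm_mul_sqrt_rpow p (by positivity)]
  exact integral_abs_sum_rpow_le hY hind hM hv hp s

lemma le_lpNorm_sum (hY : ∀ i, IsSymmetricNBU (Y i) P) (hind : iIndepFun Y P)
    (hM : 0 ≤ M) (hv : ∀ i, Var[Y i; P] ≤ M) (hp : 2 ≤ p) (s : Finset ι) :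
    gaussianNorm p * √(max 0 (∑ i ∈ s, Var[Y i; P] - (p / 2 + 2) * M))
      ≤ lpNorm (fun ω => ∑ i ∈ s, Y i ω) (ENNReal.ofReal p) P := by
  have hp₀ : 0 < p := by linarith
  have hγ := gaussianNorm_nonneg p
  rw [← Real.rpow_le_rpow_iff (by positivity) lpNorm_nonneg hp₀,
    lpNorm_ofReal_rpow hp₀ (memLp_sum hY s p), gaussianNorm_mul_sqrt_rpow p (le_max_left _ _)]
  exact le_integral_abs_sum_rpow hY hind hM hv hp s

lemma abs_lpNorm_sum_sub_le (hY : ∀ i, IsSymmetricNBU (Y i) P) (hind : iIndepFun Y P)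
    (hM : 0 ≤ M) (hv : ∀ i, Var[Y i; P] ≤ M) (hp : 2 ≤ p) (s : Finset ι) :
    |lpNorm (fun ω => ∑ i ∈ s, Y i ω) (ENNReal.ofReal p) P
      - gaussianNorm p * √(∑ i ∈ s, Var[Y i; P])| ≤ p * √M := by
  set V := ∑ i ∈ s, Var[Y i; P]
  have hV : 0 ≤ V := Finset.sum_nonneg fun i _ => variance_nonneg _ _
  have hγ := gaussianNorm_nonneg p
  have herror : gaussianNorm p * √((p / 2 + 2) * M) ≤ p * √M := by
    rw [Real.sqrt_mul (by linarith), ← mul_assoc]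
    exact mul_le_mul_of_nonneg_right (gaussianNorm_mul_sqrt_le hp) (Real.sqrt_nonneg M)
  have hupper : √(V + p / 2 * M) ≤ √V + √((p / 2 + 2) * M) :=
    (Real.sqrt_le_sqrt (by linarith)).trans (sqrt_add_le_sqrt_add_sqrt hV (by positivity))
  have hlower : √V ≤ √(max 0 (V - (p / 2 + 2) * M)) + √((p / 2 + 2) * M) :=
    (Real.sqrt_le_sqrt (by linarith [le_max_right 0 (V - (p / 2 + 2) * M)])).trans
      (sqrt_add_le_sqrt_add_sqrt (le_max_left _ _) (by positivity))
  rw [abs_le]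
  constructor
  · linarith [le_lpNorm_sum hY hind hM hv hp s, mul_le_mul_of_nonneg_left hlower hγ]
  · linarith [lpNorm_sum_le hY hind hM hv hp s, mul_le_mul_of_nonneg_left hupper hγ]

end Norms

namespace HasLogConcaveTails

variable {Ω : Type*} [MeasurableSpace Ω] {P : Measure Ω} [IsProbabilityMeasure P] {X : Ω → ℝ}

lemma measure_add_rpow_le (h : HasLogConcaveTails X P) {s t : ℝ} (hs : 0 ≤ s) (ht : 0 ≤ t)
    (hst : 0 < s + t) : P {ω | s + t ≤ |X ω|} ^ (s / (s + t)) ≤ P {ω | s ≤ |X ω|} := by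
  have hconc := h (s + t) 0 (s / (s + t)) (t / (s + t)) hst.le le_rfl (by positivity)
    (by positivity) (by rw [← add_div, div_self hst.ne'])
  rw [← ENNReal.log_le_log_iff, ENNReal.log_rpow]
  simpa [div_mul_cancel₀ s hst.ne'] using hconc

lemma measure_add_le (h : HasLogConcaveTails X P) {s t : ℝ} (hs : 0 ≤ s) (ht : 0 ≤ t) :
    P {ω | s + t ≤ |X ω|} ≤ P {ω | s ≤ |X ω|} * P {ω | t ≤ |X ω|} := by
  rcases (add_nonneg hs ht).eq_or_lt with hst | hst
  · obtain ⟨rfl, rfl⟩ := (add_eq_zero_iff_of_nonneg hs ht).1 hst.symm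
    simp
  have hts := h.measure_add_rpow_le ht hs (add_comm s t ▸ hst)
  rw [add_comm t s] at hts
  calc P {ω | s + t ≤ |X ω|}
      = P {ω | s + t ≤ |X ω|} ^ (s / (s + t)) * P {ω | s + t ≤ |X ω|} ^ (t / (s + t)) := by
        rw [← ENNReal.rpow_add_of_nonneg _ _ (by positivity) (by positivity), ← add_div,
          div_self hst.ne', ENNReal.rpow_one]
    _ ≤ P {ω | s ≤ |X ω|} * P {ω | t ≤ |X ω|} :=
        mul_le_mul' (h.measure_add_rpow_le hs ht hst) hts

lemma isSymmetricNBU (h : HasLogConcaveTails X P) (hX : IsSymmetricRV X P) (hX₂ : MemLp X 2 P) :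
    IsSymmetricNBU X P where
  symm := hX
  memLp_two := hX₂
  measure_add_le _ _ := h.measure_add_le

end HasLogConcaveTails

lemma IsSymmetricNBU.const_mul {Ω : Type*} [MeasurableSpace Ω] {P : Measure Ω}
    [IsProbabilityMeasure P] {Y : Ω → ℝ} (hY : IsSymmetricNBU Y P) (a : ℝ) :
    IsSymmetricNBU (fun ω => a * Y ω) P where
  symm := by
    simpa only [IsSymmetricRV, Function.comp_def, mul_neg] using
      IdentDistrib.comp hY.symm (measurable_const_mul a)
  memLp_two := hY.memLp_two.const_mul a
  measure_add_le s t hs ht := by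
    rcases eq_or_ne a 0 with rfl | ha
    · rcases ht.eq_or_lt with rfl | ht
      · simp
      · simp [(add_pos_of_nonneg_of_pos hs ht).not_ge]
    · have hscale (r : ℝ) : {ω | r ≤ |a * Y ω|} = {ω | r / |a| ≤ |Y ω|} := by
        ext ω
        simp only [Set.mem_ofPred_eq, abs_mul, div_le_iff₀' (abs_pos.2 ha)]
      rw [hscale, hscale, hscale, add_div]
      exact hY.measure_add_le (by positivity) (by positivity)

theorem corollary3_general {Ω : Type*} [MeasurableSpace Ω] {P : Measure Ω}
    [IsProbabilityMeasure P] {ι : Type*} [Fintype ι] {Y : ι → Ω → ℝ}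
    (hY : ∀ i, IsSymmetricNBU (Y i) P) (hind : iIndepFun Y P) {p : ℝ} (hp : 2 ≤ p) :
    MemLp (fun ω => ∑ i, Y i ω) (ENNReal.ofReal p) P ∧
      |lpNorm (fun ω => ∑ i, Y i ω) (ENNReal.ofReal p) P - gaussianNorm p * √(∑ i, Var[Y i; P])|
        ≤ p * ⨆ i, √(Var[Y i; P]) := by
  set m := ⨆ i, √(Var[Y i; P])
  have hm : 0 ≤ m := Real.iSup_nonneg fun i => Real.sqrt_nonneg _
  have hv (i : ι) : Var[Y i; P] ≤ m ^ 2 :=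
    (Real.sqrt_le_left hm).1 (le_ciSup (Set.finite_range fun i => √(Var[Y i; P])).bddAbove i)
  refine ⟨memLp_sum hY Finset.univ p, ?_⟩
  simpa only [Real.sqrt_sq hm] using
    abs_lpNorm_sum_sub_le hY hind (sq_nonneg m) hv hp Finset.univ

theorem corollary3 {Ω : Type*} [MeasurableSpace Ω] (P : Measure Ω) [IsProbabilityMeasure P]
    (n : ℕ) (X : Fin n → Ω → ℝ) (a : Fin n → ℝ) (p : ℝ)
    (hmeas : ∀ i, Measurable (X i))
    (hindep : iIndepFun X P)
    (hsymm : ∀ i, IsSymmetricRV (X i) P)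
    (htail : ∀ i, HasLogConcaveTails (X i) P)
    (hvar : ∀ i, ∫ ω, (X i ω) ^ 2 ∂P = 1)
    (hp : 3 ≤ p) :
    MemLp (fun ω => ∑ i, a i * X i ω) (ENNReal.ofReal p) P ∧
      |lpNorm (fun ω => ∑ i, a i * X i ω) (ENNReal.ofReal p) P
          - gaussianNorm p * √(∑ i, a i ^ 2)|
        ≤ p * ⨆ i, |a i| := by
  have hX (i : Fin n) : IsSymmetricNBU (X i) P := (htail i).isSymmetricNBU (hsymm i) <|
    (memLp_two_iff_integrable_sq (hmeas i).aestronglyMeasurable).2 <|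
      Integrable.of_integral_ne_zero (by simp [hvar])
  simpa only [variance_const_mul, (hsymm _).variance_eq, hvar, mul_one, Real.sqrt_sq_eq_abs] using
    corollary3_general (fun i => (hX i).const_mul (a i))
      (hindep.comp (fun i x => a i * x) fun i => measurable_const_mul (a i))
      (by linarith : 2 ≤ p)
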